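/- Let $\varphi>0$ and $\vartheta\ge 0$ be real; if $\vartheta=0$, assume that $\varphi$ is not an integer; if $\vartheta$ is not an integer, assume $\vartheta\ge\varphi$. Let $g$ be a complex-valued function analytic on a neighbourhood of $[-1,1]$ in $\mathbb C$, and put $$u(x)=g(x)\,(1-x^2)^{\varphi}\,\log^{\vartheta}(1-x^2),\qquad x\in[-1,1]$$ (principal power of the logarithm; $u(\pm1)=0$). Let $T_n$ be the Chebyshev polynomials. Let $$a_n=\frac{2}{\pi}\int_{-1}^1\frac{u(x)T_n(x)}{\sqrt{1-x^2}}\,dx\quad(n\ge1),\qquad a_0=\frac1\pi\int_{-1}^1\frac{u(x)}{\sqrt{1-x^2}}\,dx$$ be the Chebyshev coefficients of $u$; let $b_n$ be its coefficients in the difference basis $T_{n+2}-T_n$, i.e. $b_0=-a_0$, $b_1=-a_1$, $b_{n-2}-b_n=a_n$ for $n\ge2$; and, if $\varphi>\tfrac12$, let $c_n$ be its coefficients in the quadratic-factor basis $(1-x^2)T_n$, i.e. the Chebyshev coefficients of $u(x)/(1-x^2)$. Then, uniformly on $[-1,1]$, $$u=\sum_{n\ge0}a_nT_n=\sum_{n\ge0}b_n(T_{n+2}-T_n),\qquad\text{and,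 if }\varphi>\tfrac12,\quad u=\sum_{n\ge0}c_n(1-x^2)T_n .$$ Moreover there is a sequence $L(n)\in\mathbb C$, nonzero for large $n$, that varies more slowly than any power of $n$ ($L(\lfloor rn\rfloor)/L(n)\to1$ for every $r>0$, and $L(n)=o(n^{\varepsilon})$, $n^{-\varepsilon}=o(L(n))$ for every $\varepsilon>0$), such that, with $A(n)=\bigl(g(1)+(-1)^n g(-1)\bigr)L(n)$, as $n\to\infty$, $$a_n\sim\frac{A(n)}{n^{2\varphi+1}},\qquad b_n\sim\frac{A(n)}{4\varphi}\,\frac1{n^{2\varphi}},\qquad c_n\sim-\frac{A(n)}{(2\varphi-1)(2\varphi)}\,\frac1{n^{2\varphi-1}}\quad(\text{the last if }\varphi>\tfrac12).$$ Here $\sim$ means that the ratio of the two sides tends to $1$ as $n\to\infty$ through those parities for which $g(1)+(-1)^ng(-1)\ne0$; along a parity for which $g(1)+(-1)^ng(-1)=0$ it means $a_n=o(L(n)/n^{2\varphi+1})$, $b_n=o(L(n)/n^{2\varphi})$ and, if $\varphi>\tfrac12$, $c_n=o(L(n)/n^{2\varphi-1})$. -/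

import Mathlib

open Filter Topology Asymptotics Set

noncomputable section

/-- The Chebyshev polynomial `T_n` evaluated at a real point. -/
def chebT (n : ℕ) (x : ℝ) : ℝ := (Polynomial.Chebyshev.T ℝ (n : ℤ)).eval x

/-- The function `u(x) = g(x) (1 - x²)^φ log^ϑ(1 - x²)`. Since `log (1 - x²) ≤ 0` on `(-1, 1)`, its
`ϑ`-th power is the principal complex power, which is the ordinary power for `ϑ = 0, 1, 2, …`. -/
def endpointSingular (g : ℂ → ℂ) (φ ϑ : ℝ) (x : ℝ) : ℂ :=
  g (x : ℂ) * (((1 - x ^ 2) ^ φ : ℝ) : ℂ) * ((Real.log (1 - x ^ 2) : ℝ) : ℂ) ^ (ϑ : ℂ)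

/-- Chebyshev coefficients: `(2/π) ∫ u T_n / √(1 - x²)` over `[-1, 1]`, with `1/π` in place of
`2/π` for `n = 0`. -/
def chebCoeff (u : ℝ → ℂ) (n : ℕ) : ℂ :=
  ((if n = 0 then 1 else 2) / (Real.pi : ℂ)) *
    ∫ x in (-1 : ℝ)..1, u x * ((chebT n x / Real.sqrt (1 - x ^ 2) : ℝ) : ℂ)

/-- The sequence `b` with `b₀ = -a₀`, `b₁ = -a₁` and `b_{n-2} - b_n = a_n` for `n ≥ 2`. -/
def differenceSolution (a : ℕ → ℂ) : ℕ → ℂ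
  | 0 => -a 0
  | 1 => -a 1
  | n + 2 => differenceSolution a n - a (n + 2)

/-- Coefficients of `u` in the difference basis `T_{n+2} - T_n`. -/
def diffCoeff (u : ℝ → ℂ) : ℕ → ℂ := differenceSolution (chebCoeff u)

/-- Coefficients of `u` in the quadratic-factor basis `(1 - x²) T_n`: the Chebyshev coefficients
of `v(x) = u(x) / (1 - x²)`. -/
def quadCoeff (u : ℝ → ℂ) : ℕ → ℂ := chebCoeff fun x => u x / ((1 - x ^ 2 : ℝ) : ℂ)

/-- The series `∑ cₙ eₙ` has partial sums converging to `u` uniformly on `[-1, 1]`. -/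
def ExpandsIn (e : ℕ → ℝ → ℝ) (c : ℕ → ℂ) (u : ℝ → ℂ) : Prop :=
  TendstoUniformlyOn (fun N x => ∑ n ∈ Finset.range N, c n * (e n x : ℂ)) u atTop (Icc (-1) 1)

/-- Slow variation in the sense of Karamata, together with `n^(-ε) ≪ |L n| ≪ n^ε` for
every `ε > 0`. -/
structure SlowlyVarying (L : ℕ → ℂ) : Prop where
  ratio : ∀ r : ℝ, 0 < r → Tendsto (fun n : ℕ => L ⌊r * n⌋₊ / L n) atTop (𝓝 1)
  upper : ∀ ε : ℝ, 0 < ε → L =o[atTop] fun n : ℕ => (n : ℝ) ^ ε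
  lower : ∀ ε : ℝ, 0 < ε → (fun n : ℕ => (n : ℝ) ^ (-ε)) =o[atTop] L

/-- `s n ~ t n` as `n → ∞` through the indices with `t n ≠ 0`, and `s n = o(σ n)` as `n → ∞`
through the indices with `t n = 0`. -/
def SimWithScale (s t σ : ℕ → ℂ) : Prop :=
  (s ~[atTop ⊓ 𝓟 {n | t n ≠ 0}] t) ∧ (s =o[atTop ⊓ 𝓟 {n | t n = 0}] σ)

end

open scoped ComplexConjugate

noncomputable section

/-! Under x = cos θ the Chebyshev coefficients become cosine coefficients. On [0, π/2] one has u(cos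
θ) = e^{iπϑ} g(cos θ) K(θ), where K(z) = (sin z)^{2φ} (-2 log sin z)^ϑ (`singKernel`) is real on the
segment and holomorphic just below it. The other half of [0, π] is folded onto this one, with a sign
(-1)^n (`integral_cos_fold`).

Split cos nθ into exponentials. The part with e^{-inθ} is pushed into the lower half plane, at the
cost of an exponentially small term and integrals down the verticals through 0 and π/2. The part
with e^{inθ} is the conjugate of an integral of the same kind. The folded factor H has the
symmetries of cos, so in the sum K enters only through K - conj K = 2i Im K, and two Laplace
integrals against e^{-ny} remain (`integral_mul_cos_deform`).

At 0, Im K(-iy) behaves like κ y^{2φ} (-log y)^m with κ ≠ 0. For φ not an integer, m = ϑ and κ is a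
multiple of sin(-φπ); for integral φ that sine vanishes, and the slowly decaying argument of the
logarithm supplies the next order, m = ϑ - 1. At π/2, the zero of log(1 - x²) at x = 0, Im K is a
multiple of sin(ϑπ) and of order y^{2ϑ}; the assumption ϑ ≥ φ for nonintegral ϑ makes it negligible
(`exists_singKernel_im_asymptotics`). An Abelian theorem (`tendsto_laplace_div_logPow`) then gives
a_n = (C (g(1) + (-1)^n g(-1)) + o(1)) log^m n / n^{2φ+1}, and L(n) = C log^m n.

The rest is summation. The a_n are absolutely summable, so the Chebyshev series converges uniformly;
its values 0 at ±1 force b_n → 0. As b_n - b_{n+2} = a_{n+2}, the asymptotics of b_n come from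
summing tails (`LogPowAsymp.sum_tail`). The cosine coefficients of u/(1 - x²) tend to 0 by
Riemann-Lebesgue and have differences -4 b_n (`cosCoeff_sub_eq_diffCoeff`), so the same argument
gives c_n. Both remaining expansions follow from summation by parts with vanishing remainders. -/

/-! ### The substitution x = cos θ and uniform convergence of the Chebyshev series -/

lemma chebT_cos (n : ℕ) (θ : ℝ) : chebT n (Real.cos θ) = Real.cos (n * θ) := by
  simp [chebT, Polynomial.Chebyshev.T_real_cos]

lemma abs_chebT_le_one (n : ℕ) {x : ℝ} (hx : x ∈ Icc (-1 : ℝ) 1) : |chebT n x| ≤ 1 := by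
  rw [← Real.cos_arccos hx.1 hx.2, chebT_cos]
  exact Real.abs_cos_le_one _

/-- Monotone change of variables needs no integrability, so this also applies to u/(1 - x²), which
may be unbounded at ±1. -/
lemma integral_div_sqrt_eq_integral_cos (f : ℝ → ℂ) (q : ℝ → ℝ) :
    ∫ x in (-1 : ℝ)..1, f x * ((q x / Real.sqrt (1 - x ^ 2) : ℝ) : ℂ) =
      ∫ θ in (0 : ℝ)..Real.pi, f (Real.cos θ) * ((q (Real.cos θ) : ℝ) : ℂ) := by
  have h := MeasureTheory.integral_Icc_deriv_smul_of_deriv_nonpos (a := 0) (b := Real.pi)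
    (f := Real.cos) (f' := fun x => -Real.sin x)
    (g := fun x => f x * ((q x / Real.sqrt (1 - x ^ 2) : ℝ) : ℂ))
    Real.continuous_cos.continuousOn (fun x _ => Real.hasDerivAt_cos x)
    (fun x hx => by have := Real.sin_nonneg_of_nonneg_of_le_pi hx.1.le hx.2.le; linarith)
    Real.pi_pos.le
  simp only [Real.cos_zero, Real.cos_pi] at h
  rw [intervalIntegral.integral_of_le (by norm_num), intervalIntegral.integral_of_le Real.pi_pos.le,
    ← MeasureTheory.integral_Icc_eq_integral_Ioc, ← neg_eq_iff_eq_neg.mpr h,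
    ← MeasureTheory.integral_neg, MeasureTheory.integral_Icc_eq_integral_Ioo,
    MeasureTheory.integral_Ioc_eq_integral_Ioo]
  refine MeasureTheory.setIntegral_congr_fun measurableSet_Ioo fun θ hθ => ?_
  have hs : 0 < Real.sin θ := Real.sin_pos_of_pos_of_lt_pi hθ.1 hθ.2
  have h1 : Real.sqrt (1 - Real.cos θ ^ 2) = Real.sin θ := by
    rw [← Real.sin_sq, Real.sqrt_sq hs.le]
  simp only [h1, Complex.real_smul]
  have : (Complex.sin (θ : ℂ)) ≠ 0 := by exact_mod_cast hs.ne'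
  push_cast
  field_simp

lemma chebCoeff_eq_integral_cos (u : ℝ → ℂ) (n : ℕ) :
    chebCoeff u n = ((if n = 0 then 1 else 2) / (Real.pi : ℂ)) *
      ∫ θ in (0 : ℝ)..Real.pi, u (Real.cos θ) * ((Real.cos (n * θ) : ℝ) : ℂ) := by
  rw [chebCoeff, integral_div_sqrt_eq_integral_cos]
  simp only [chebT_cos]

/-- The function `θ ↦ u (cos θ)` on the circle. -/
def cosLift (u : ℝ → ℂ) (hu : ContinuousOn u (Icc (-1) 1)) : C(AddCircle (2 * Real.pi), ℂ) where
  toFun t := u (Real.Angle.cos t)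
  continuous_toFun := by
    refine hu.comp_continuous Real.Angle.continuous_cos fun t => ?_
    induction t using Real.Angle.induction_on with
    | _ t => exact ⟨Real.neg_one_le_cos t, Real.cos_le_one t⟩

instance fact_two_pi_pos : Fact (0 < 2 * Real.pi) := ⟨Real.two_pi_pos⟩

lemma cosLift_coe (u : ℝ → ℂ) (hu : ContinuousOn u (Icc (-1) 1)) (θ : ℝ) :
    cosLift u hu (θ : AddCircle (2 * Real.pi)) = u (Real.cos θ) := rfl

lemma continuous_comp_cos {u : ℝ → ℂ} (hu : ContinuousOn u (Icc (-1) 1)) :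
    Continuous fun θ => u (Real.cos θ) :=
  hu.comp_continuous Real.continuous_cos fun θ => ⟨Real.neg_one_le_cos θ, Real.cos_le_one θ⟩

lemma fourierCoeff_cosLift (u : ℝ → ℂ) (hu : ContinuousOn u (Icc (-1) 1)) (n : ℤ) :
    fourierCoeff (cosLift u hu) n = (1 / (Real.pi : ℂ)) *
      ∫ θ in (0 : ℝ)..Real.pi, u (Real.cos θ) * ((Real.cos (n * θ) : ℝ) : ℂ) := by
  have hc := continuous_comp_cos hu
  have hi : ∀ a b : ℝ, IntervalIntegrable
      (fun θ : ℝ => Complex.exp (-(n * θ * Complex.I)) * u (Real.cos θ)) MeasureTheory.volume a b :=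
    fun a b => by
      exact ((by fun_prop : Continuous _).mul hc).intervalIntegrable _ _
  have hi' : ∀ a b : ℝ, IntervalIntegrable
      (fun θ : ℝ => Complex.exp (n * θ * Complex.I) * u (Real.cos θ)) MeasureTheory.volume a b :=
    fun a b => by
      exact ((by fun_prop : Continuous _).mul hc).intervalIntegrable _ _
  rw [fourierCoeff_eq_intervalIntegral _ _ (-Real.pi)]
  have e1 : ∀ θ : ℝ, (fourier (-n) (θ : AddCircle (2 * Real.pi)) : ℂ) •
      cosLift u hu (θ : AddCircle (2 * Real.pi)) =
      Complex.exp (-(n * θ * Complex.I)) * u (Real.cos θ) := by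
    intro θ
    rw [fourier_coe_apply, cosLift_coe, smul_eq_mul]
    congr 2
    have : (Real.pi : ℂ) ≠ 0 := by exact_mod_cast Real.pi_ne_zero
    push_cast
    field_simp
  simp only [e1]
  rw [show -Real.pi + 2 * Real.pi = Real.pi by ring,
    ← intervalIntegral.integral_add_adjacent_intervals (hi (-Real.pi) 0) (hi 0 Real.pi)]
  have e2 : ∫ θ in (-Real.pi)..0, Complex.exp (-(n * θ * Complex.I)) * u (Real.cos θ) =
      ∫ θ in (0 : ℝ)..Real.pi, Complex.exp (n * θ * Complex.I) * u (Real.cos θ) := by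
    have := intervalIntegral.integral_comp_neg (a := 0) (b := Real.pi)
      (fun θ : ℝ => Complex.exp (-(n * θ * Complex.I)) * u (Real.cos θ))
    rw [neg_zero] at this
    rw [← this]
    simp
  rw [e2, ← intervalIntegral.integral_add (hi' _ _) (hi _ _), Complex.real_smul]
  have e3 : ∀ θ : ℝ, Complex.exp (n * θ * Complex.I) * u (Real.cos θ) +
      Complex.exp (-(n * θ * Complex.I)) * u (Real.cos θ) =
      2 * (u (Real.cos θ) * ((Real.cos (n * θ) : ℝ) : ℂ)) := by
    intro θ
    push_cast
    rw [Complex.cos]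
    ring_nf
  simp only [e3]
  rw [intervalIntegral.integral_const_mul]
  push_cast
  ring

/-- Summable Fourier coefficients give pointwise convergence to u(cos θ); the Weierstrass test with
|T_n| ≤ 1 makes it uniform. -/
lemma expandsIn_chebT_of_summable {u : ℝ → ℂ} (hu : ContinuousOn u (Icc (-1) 1))
    (hs : Summable (chebCoeff u)) : ExpandsIn chebT (chebCoeff u) u := by
  have key : ∀ n : ℕ, n ≠ 0 → fourierCoeff (cosLift u hu) n = chebCoeff u n / 2 := by
    intro n hn
    rw [fourierCoeff_cosLift, chebCoeff_eq_integral_cos, if_neg hn]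
    push_cast
    ring
  have key' : ∀ n : ℕ, fourierCoeff (cosLift u hu) (-n) = fourierCoeff (cosLift u hu) n := by
    intro n
    rw [fourierCoeff_cosLift, fourierCoeff_cosLift]
    simp
  have key0 : fourierCoeff (cosLift u hu) 0 = chebCoeff u 0 := by
    rw [fourierCoeff_cosLift, chebCoeff_eq_integral_cos]
    simp
  have hs1 : Summable fun n : ℕ => fourierCoeff (cosLift u hu) n := by
    rw [← summable_nat_add_iff 1] at hs ⊢
    refine (hs.div_const 2).congr fun n => ?_
    rw [key _ (Nat.succ_ne_zero n)]
  have hs2 : Summable (fourierCoeff (cosLift u hu)) :=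
    Summable.of_nat_of_neg hs1 (by simpa only [key'] using hs1)
  have hpt : ∀ x ∈ Icc (-1 : ℝ) 1, HasSum (fun n => chebCoeff u n * (chebT n x : ℂ)) (u x) := by
    intro x hx
    obtain ⟨θ, rfl⟩ : ∃ θ, Real.cos θ = x := ⟨_, Real.cos_arccos hx.1 hx.2⟩
    have h1 := (has_pointwise_sum_fourier_series_of_summable hs2
      (θ : AddCircle (2 * Real.pi))).nat_add_neg
    -- Pairing n with -n counts the index 0 twice, so one copy of a_0 is removed.
    have h2 := h1.sub (hasSum_ite_eq (0 : ℕ) (chebCoeff u 0))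
    rw [cosLift_coe, show u (Real.cos θ) + fourierCoeff (cosLift u hu) 0 •
      fourier 0 (θ : AddCircle (2 * Real.pi)) - chebCoeff u 0 = u (Real.cos θ) by
        simp [key0]] at h2
    refine h2.congr_fun fun n => ?_
    · have hpi : (Real.pi : ℂ) ≠ 0 := by exact_mod_cast Real.pi_ne_zero
      rw [fourier_coe_apply, fourier_coe_apply, key', smul_eq_mul, smul_eq_mul, chebT_cos]
      rcases eq_or_ne n 0 with rfl | hn
      · simp [key0]
      · rw [key n hn, if_neg hn]
        push_cast
        rw [Complex.cos]
        have e1 : 2 * (Real.pi : ℂ) * Complex.I * n * θ / (2 * Real.pi) = n * θ * Complex.I := by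
          field_simp
        have e2 : 2 * (Real.pi : ℂ) * Complex.I * -n * θ / (2 * Real.pi) =
            -(n * θ) * Complex.I := by
          field_simp
        rw [e1, e2]
        ring
  have hM := tendstoUniformlyOn_tsum_nat (f := fun n x => chebCoeff u n * (chebT n x : ℂ))
    (s := Icc (-1) 1) hs.norm fun n x hx => by
      rw [norm_mul, Complex.norm_real]
      exact mul_le_of_le_one_right (norm_nonneg _) (abs_chebT_le_one n hx)
  exact hM.congr_right fun x hx => (hpt x hx).tsum_eq

/-! ### The difference basis -/

/-- Summation by parts: partial sums in the difference basis. -/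
lemma sum_chebCoeff_eq_sum_diffCoeff (a : ℕ → ℂ) (x : ℝ) (N : ℕ) :
    ∑ n ∈ Finset.range (N + 2), a n * (chebT n x : ℂ) =
      ∑ n ∈ Finset.range N, differenceSolution a n * ((chebT (n + 2) x - chebT n x : ℝ) : ℂ) -
        differenceSolution a N * (chebT N x : ℂ) -
        differenceSolution a (N + 1) * (chebT (N + 1) x : ℂ) := by
  induction N with
  | zero => simp [Finset.sum_range_succ, differenceSolution]
  | succ N ih =>
    rw [show N + 1 + 2 = (N + 2) + 1 by ring, Finset.sum_range_succ, ih,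
      Finset.sum_range_succ _ N, differenceSolution]
    push_cast
    ring

lemma expandsIn_of_tendstoUniformlyOn_sub {e : ℕ → ℝ → ℝ} {c : ℕ → ℂ} {u : ℝ → ℂ}
    {S : ℕ → ℝ → ℂ} (hS : TendstoUniformlyOn S u atTop (Icc (-1) 1)) {r : ℕ → ℝ}
    (hr : Tendsto r atTop (𝓝 0))
    (hle : ∀ᶠ N in atTop, ∀ x ∈ Icc (-1 : ℝ) 1,
      ‖∑ n ∈ Finset.range N, c n * (e n x : ℂ) - S N x‖ ≤ r N) : ExpandsIn e c u := by
  rw [ExpandsIn, Metric.tendstoUniformlyOn_iff]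
  rw [Metric.tendstoUniformlyOn_iff] at hS
  intro ε hε
  filter_upwards [hS (ε / 2) (half_pos hε), hle, hr.eventually_lt_const (half_pos hε)]
    with N h1 h2 h3 x hx
  calc dist (u x) (∑ n ∈ Finset.range N, c n * (e n x : ℂ))
      ≤ dist (u x) (S N x) + dist (S N x) (∑ n ∈ Finset.range N, c n * (e n x : ℂ)) :=
        dist_triangle _ _ _
    _ < ε / 2 + ε / 2 := by
        refine add_lt_add (h1 x hx) ?_
        rw [dist_comm, dist_eq_norm]
        exact (h2 x hx).trans_lt h3
    _ = ε := add_halves ε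

lemma expandsIn_diff {u : ℝ → ℂ} (hexp : ExpandsIn chebT (chebCoeff u) u)
    (hb : Tendsto (diffCoeff u) atTop (𝓝 0)) :
    ExpandsIn (fun n x => chebT (n + 2) x - chebT n x) (diffCoeff u) u := by
  have h2 : TendstoUniformlyOn
      (fun N x => ∑ n ∈ Finset.range (N + 2), chebCoeff u n * (chebT n x : ℂ)) u atTop
      (Icc (-1) 1) := by
    intro v hv
    exact (tendsto_add_atTop_nat 2).eventually (hexp v hv)
  refine expandsIn_of_tendstoUniformlyOn_sub h2
    (r := fun N => ‖diffCoeff u N‖ + ‖diffCoeff u (N + 1)‖) ?_ ?_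
  · simpa using hb.norm.add ((tendsto_add_atTop_iff_nat 1).2 hb).norm
  · refine Eventually.of_forall fun N x hx => ?_
    rw [sum_chebCoeff_eq_sum_diffCoeff]
    simp only [diffCoeff]
    rw [show ∀ A B C : ℂ, A - (A - B - C) = B + C by intros; ring]
    refine (norm_add_le _ _).trans (add_le_add ?_ ?_) <;>
    · rw [norm_mul, Complex.norm_real]
      exact mul_le_of_le_one_right (norm_nonneg _) (abs_chebT_le_one _ hx)

lemma chebT_one_right (n : ℕ) : chebT n 1 = 1 := by simp [chebT]

lemma chebT_neg_one_right (n : ℕ) : chebT n (-1) = (-1) ^ n := by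
  have := chebT_cos n Real.pi
  rwa [Real.cos_pi, Real.cos_nat_mul_pi] at this

/-- At x = 1 and x = -1 the difference basis vanishes, so only the remainder of the summation by
parts survives: it shows that b_N + b_{N+1} and, up to sign, b_N - b_{N+1} tend to 0. -/
lemma tendsto_diffCoeff_zero {u : ℝ → ℂ} (hexp : ExpandsIn chebT (chebCoeff u) u)
    (h1 : u 1 = 0) (h2 : u (-1) = 0) : Tendsto (diffCoeff u) atTop (𝓝 0) := by
  have t1 := (tendsto_add_atTop_iff_nat 2).2 (hexp.tendsto_at (x := 1) (by simp))
  have t2 := (tendsto_add_atTop_iff_nat 2).2 (hexp.tendsto_at (x := -1) (by simp))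
  rw [h1] at t1
  rw [h2] at t2
  simp only [sum_chebCoeff_eq_sum_diffCoeff] at t1 t2
  simp only [chebT_one_right, chebT_neg_one_right, pow_add] at t1 t2
  norm_num at t1 t2
  have t2' := squeeze_zero_norm (a := fun n => ‖-(differenceSolution (chebCoeff u) n * (-1) ^ n) +
    differenceSolution (chebCoeff u) (n + 1) * (-1) ^ n‖)
    (f := fun n => -differenceSolution (chebCoeff u) n +
      differenceSolution (chebCoeff u) (n + 1))
    (fun n => by
      rw [← neg_mul, ← add_mul, norm_mul, norm_pow]; simp) (by simpa using t2.norm)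
  have t3 := (t1.add t2').div_const (-2)
  simp only [diffCoeff]
  convert t3 using 2
  · ring
  · simp

/-! ### Cosine coefficients and the quadratic-factor basis -/

/-- The cosine coefficients `(2/π) ∫ f(θ) cos(nθ) dθ` over `[0, π]`. -/
def cosCoeff (f : ℝ → ℂ) (n : ℕ) : ℂ :=
  (2 / (Real.pi : ℂ)) * ∫ θ in (0 : ℝ)..Real.pi, f θ * ((Real.cos (n * θ) : ℝ) : ℂ)

lemma intervalIntegrable_mul_cos {f : ℝ → ℂ} {a b : ℝ}
    (hf : IntervalIntegrable f MeasureTheory.volume a b) (n : ℕ) :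
    IntervalIntegrable (fun θ => f θ * ((Real.cos (n * θ) : ℝ) : ℂ)) MeasureTheory.volume a b :=
  hf.mul_continuousOn (by fun_prop)

lemma integral_mul_cos_eq_exp {f : ℝ → ℂ} {a b : ℝ}
    (hf : IntervalIntegrable f MeasureTheory.volume a b) (n : ℕ) :
    ∫ θ in a..b, f θ * ((Real.cos (n * θ) : ℝ) : ℂ) =
      ((∫ θ in a..b, f θ * Complex.exp (-(n * θ * Complex.I))) +
        ∫ θ in a..b, f θ * Complex.exp (n * θ * Complex.I)) / 2 := by
  rw [← intervalIntegral.integral_add (hf.mul_continuousOn (by fun_prop))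
    (hf.mul_continuousOn (by fun_prop)), ← intervalIntegral.integral_div]
  congr 1
  ext θ
  push_cast
  rw [Complex.cos]
  ring_nf

/-- Riemann-Lebesgue at the frequencies ±n/(2π), for f cut off to (0, π]. -/
lemma tendsto_cosCoeff_zero {f : ℝ → ℂ}
    (hf : IntervalIntegrable f MeasureTheory.volume 0 Real.pi) :
    Tendsto (cosCoeff f) atTop (𝓝 0) := by
  have hRL := Real.tendsto_integral_exp_smul_cocompact ((Ioc 0 Real.pi).indicator f)
  have hpi : (Real.pi : ℂ) ≠ 0 := by exact_mod_cast Real.pi_ne_zero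
  have e : ∀ w : ℝ, (∫ v : ℝ, Real.fourierChar (-(v * w)) • (Ioc 0 Real.pi).indicator f v) =
      ∫ θ in (0 : ℝ)..Real.pi, f θ * Complex.exp (-(2 * Real.pi * w * θ * Complex.I)) := by
    intro w
    rw [intervalIntegral.integral_of_le Real.pi_pos.le,
      ← MeasureTheory.integral_indicator measurableSet_Ioc]
    congr 1
    ext v
    by_cases hv : v ∈ Ioc 0 Real.pi
    · rw [indicator_of_mem hv, indicator_of_mem hv, Circle.smul_def, Real.fourierChar_apply,
        smul_eq_mul, mul_comm]
      congr 2
      push_cast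
      ring
    · rw [indicator_of_notMem hv, indicator_of_notMem hv, smul_zero]
  simp only [e] at hRL
  have hnat : Tendsto (fun n : ℕ => (n : ℝ) / (2 * Real.pi)) atTop atTop :=
    tendsto_natCast_atTop_atTop.atTop_div_const (by positivity)
  have l1 := hRL.comp (hnat.mono_right atTop_le_cocompact)
  have l2 := hRL.comp ((tendsto_neg_atTop_atBot.comp hnat).mono_right atBot_le_cocompact)
  have l3 := ((l1.add l2).div_const 2).const_mul (2 / (Real.pi : ℂ))
  simp only [add_zero, zero_div, mul_zero] at l3
  refine l3.congr fun n => ?_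
  rw [cosCoeff, integral_mul_cos_eq_exp hf]
  simp only [Function.comp]
  congr 5 <;>
  · ext θ
    congr 2
    push_cast
    field_simp

lemma chebCoeff_eq_cosCoeff (u : ℝ → ℂ) {n : ℕ} (hn : n ≠ 0) :
    chebCoeff u n = cosCoeff (fun θ => u (Real.cos θ)) n := by
  rw [chebCoeff_eq_integral_cos, if_neg hn, cosCoeff]

lemma chebCoeff_zero_eq_cosCoeff (u : ℝ → ℂ) :
    chebCoeff u 0 = cosCoeff (fun θ => u (Real.cos θ)) 0 / 2 := by
  rw [chebCoeff_eq_integral_cos, if_pos rfl, cosCoeff]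
  ring

/-- This is 4 sin²θ cos kθ = 2 cos kθ - cos (k-2)θ - cos (k+2)θ. The next two lemmas are k = 0 and k
= 1, where cosine coefficients of negative index are folded back by evenness; this is why `cosCoeff`
keeps the factor 2/π at index 0. -/
lemma cosCoeff_sin_sq_mul {f : ℝ → ℂ}
    (hf : IntervalIntegrable f MeasureTheory.volume 0 Real.pi) (n : ℕ) :
    4 * cosCoeff (fun θ => ((Real.sin θ ^ 2 : ℝ) : ℂ) * f θ) (n + 2) =
      2 * cosCoeff f (n + 2) - cosCoeff f n - cosCoeff f (n + 4) := by
  have h := intervalIntegrable_mul_cos hf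
  have e : ∀ θ : ℝ, ((Real.sin θ ^ 2 : ℝ) : ℂ) * f θ * ((Real.cos ((n + 2 : ℕ) * θ) : ℝ) : ℂ) =
      (1 / 4 : ℂ) * (2 * (f θ * ((Real.cos ((n + 2 : ℕ) * θ) : ℝ) : ℂ)) -
        f θ * ((Real.cos (n * θ) : ℝ) : ℂ) -
        f θ * ((Real.cos ((n + 4 : ℕ) * θ) : ℝ) : ℂ)) := by
    intro θ
    have e1 : Real.cos (n * θ) = Real.cos ((n + 2 : ℕ) * θ - 2 * θ) := by
      congr 1; push_cast; ring
    have e2 : Real.cos ((n + 4 : ℕ) * θ) = Real.cos ((n + 2 : ℕ) * θ + 2 * θ) := by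
      congr 1; push_cast; ring
    rw [e1, e2, Real.cos_sub, Real.cos_add, Real.cos_two_mul, Real.sin_sq]
    push_cast
    ring
  simp only [cosCoeff, e]
  rw [intervalIntegral.integral_const_mul, intervalIntegral.integral_sub
    (((h (n + 2)).const_mul 2).sub (h n)) (h (n + 4)),
    intervalIntegral.integral_sub ((h (n + 2)).const_mul 2) (h n),
    intervalIntegral.integral_const_mul]
  ring

lemma cosCoeff_sin_sq_mul_zero {f : ℝ → ℂ}
    (hf : IntervalIntegrable f MeasureTheory.volume 0 Real.pi) :
    2 * cosCoeff (fun θ => ((Real.sin θ ^ 2 : ℝ) : ℂ) * f θ) 0 =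
      cosCoeff f 0 - cosCoeff f 2 := by
  have h := intervalIntegrable_mul_cos hf
  simp only [cosCoeff]
  rw [← mul_sub, ← intervalIntegral.integral_sub (h 0) (h 2), mul_left_comm,
    ← intervalIntegral.integral_const_mul]
  congr 2
  ext θ
  have : Real.sin θ ^ 2 = (1 - Real.cos (2 * θ)) / 2 := by rw [Real.sin_sq, Real.cos_two_mul]; ring
  rw [this]
  push_cast
  simp
  ring

lemma cosCoeff_sin_sq_mul_one {f : ℝ → ℂ}
    (hf : IntervalIntegrable f MeasureTheory.volume 0 Real.pi) :
    4 * cosCoeff (fun θ => ((Real.sin θ ^ 2 : ℝ) : ℂ) * f θ) 1 =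
      cosCoeff f 1 - cosCoeff f 3 := by
  have h := intervalIntegrable_mul_cos hf
  simp only [cosCoeff]
  rw [← mul_sub, ← intervalIntegral.integral_sub (h 1) (h 3), mul_left_comm,
    ← intervalIntegral.integral_const_mul]
  congr 2
  ext θ
  have : Real.sin θ ^ 2 = 1 - Real.cos θ ^ 2 := Real.sin_sq θ
  rw [this]
  push_cast
  rw [Complex.cos_three_mul]
  simp
  ring

lemma cosCoeff_eq_of_eq_mul {u v : ℝ → ℂ}
    (huv : ∀ x ∈ Ioo (-1 : ℝ) 1, u x = ((1 - x ^ 2 : ℝ) : ℂ) * v x) (n : ℕ) :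
    cosCoeff (fun θ => u (Real.cos θ)) n =
      cosCoeff (fun θ => ((Real.sin θ ^ 2 : ℝ) : ℂ) * v (Real.cos θ)) n := by
  simp only [cosCoeff]
  congr 1
  refine intervalIntegral.integral_congr_Ioo_of_le Real.pi_pos.le fun θ hθ => ?_
  have hs : 0 < Real.sin θ := Real.sin_pos_of_pos_of_lt_pi hθ.1 hθ.2
  have := Real.sin_sq_add_cos_sq θ
  rw [huv _ ⟨by nlinarith, by nlinarith⟩, ← Real.sin_sq]

/-- Multiplying v by 1 - x² = sin²θ takes a second difference of step 2 of its cosine coefficients,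
up to the factor -1/4. The sequence b is one summation of a, hence a first difference of those
coefficients; the first two values of b are exactly the initial conditions needed. -/
lemma cosCoeff_sub_eq_diffCoeff {u v : ℝ → ℂ}
    (huv : ∀ x ∈ Ioo (-1 : ℝ) 1, u x = ((1 - x ^ 2 : ℝ) : ℂ) * v x)
    (hv : IntervalIntegrable (fun θ => v (Real.cos θ)) MeasureTheory.volume 0 Real.pi) (n : ℕ) :
    cosCoeff (fun θ => v (Real.cos θ)) n - cosCoeff (fun θ => v (Real.cos θ)) (n + 2) =
      -4 * diffCoeff u n := by
  induction n using Nat.twoStepInduction with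
  | zero =>
    rw [← cosCoeff_sin_sq_mul_zero hv, diffCoeff, differenceSolution, chebCoeff_zero_eq_cosCoeff,
      cosCoeff_eq_of_eq_mul huv]
    ring
  | one =>
    rw [← cosCoeff_sin_sq_mul_one hv, diffCoeff, differenceSolution,
      chebCoeff_eq_cosCoeff _ one_ne_zero, cosCoeff_eq_of_eq_mul huv]
    ring
  | more n ih _ =>
    rw [diffCoeff] at ih ⊢
    rw [differenceSolution, chebCoeff_eq_cosCoeff _ (by omega), cosCoeff_eq_of_eq_mul huv]
    linear_combination ih - cosCoeff_sin_sq_mul hv n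

lemma chebT_add_two (n : ℕ) (x : ℝ) : chebT (n + 2) x = 2 * x * chebT (n + 1) x - chebT n x := by
  have := Polynomial.Chebyshev.T_add_two ℝ (n : ℤ)
  simp [chebT, this]

/-- Summation by parts based on 4(1 - x²) T_n = (T_n - T_{n-2}) - (T_{n+2} - T_n), with T_{-k} =
T_k. The halved c_0 compensates for the symmetric term at n = 0. -/
lemma four_mul_sum_quad {c b : ℕ → ℂ} {cc : ℕ → ℂ} (h0 : c 0 = cc 0 / 2)
    (hc : ∀ n, n ≠ 0 → c n = cc n) (hb : ∀ n, cc n - cc (n + 2) = -4 * b n) (x : ℝ) (N : ℕ) :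
    4 * ∑ n ∈ Finset.range (N + 2), c n * (((1 - x ^ 2) * chebT n x : ℝ) : ℂ) =
      4 * ∑ n ∈ Finset.range (N + 2), b n * ((chebT (n + 2) x - chebT n x : ℝ) : ℂ) -
        (cc (N + 2) * ((chebT (N + 2) x - chebT N x : ℝ) : ℂ) +
          cc (N + 3) * ((chebT (N + 3) x - chebT (N + 1) x : ℝ) : ℂ)) := by
  induction N with
  | zero =>
    have t0 : chebT 0 x = 1 := by simp [chebT]
    have t1 : chebT 1 x = x := by simp [chebT]
    have t2 := chebT_add_two 0 x
    have t3 := chebT_add_two 1 x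
    norm_num at t2 t3
    simp only [Finset.sum_range_succ, Finset.sum_range_zero, h0, hc 1 one_ne_zero, zero_add,
      t3, t2, t1, t0]
    have b0 := hb 0
    have b1 := hb 1
    norm_num at b0 b1
    push_cast
    linear_combination (-(2 * x ^ 2 - 2) : ℂ) * b0 - (4 * x ^ 3 - 4 * x : ℂ) * b1
  | succ N ih =>
    rw [show N + 1 + 2 = (N + 2) + 1 by ring, Finset.sum_range_succ, mul_add, ih,
      Finset.sum_range_succ _ (N + 2), hc (N + 2) (by omega)]
    have t2 := chebT_add_two N x
    have t3 := chebT_add_two (N + 1) x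
    have t4 := chebT_add_two (N + 2) x
    have hbN := hb (N + 2)
    simp only [show N + 1 + 2 = N + 3 by ring,
      show N + 1 + 1 = N + 2 by ring, show N + 1 + 3 = N + 4 by ring] at *
    have t0 : chebT N x = 2 * x * chebT (N + 1) x - chebT (N + 2) x := by linarith
    rw [t4, t3, t0]
    push_cast
    linear_combination -(2 * (x : ℂ) * (2 * x * chebT (N + 2) x - chebT (N + 1) x) -
      chebT (N + 2) x - chebT (N + 2) x) * hbN

/-- The partial sums in the two bases differ by two terms with coefficients tending to 0, so no
summability of the c_n is needed. -/
lemma expandsIn_quad_of_cosCoeff {u v : ℝ → ℂ}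
    (huv : ∀ x ∈ Ioo (-1 : ℝ) 1, u x = ((1 - x ^ 2 : ℝ) : ℂ) * v x)
    (hv : IntervalIntegrable (fun θ => v (Real.cos θ)) MeasureTheory.volume 0 Real.pi)
    (hexp : ExpandsIn (fun n x => chebT (n + 2) x - chebT n x) (diffCoeff u) u) :
    ExpandsIn (fun n x => (1 - x ^ 2) * chebT n x) (chebCoeff v) u := by
  set cc := cosCoeff fun θ => v (Real.cos θ)
  have hcc : Tendsto cc atTop (𝓝 0) := tendsto_cosCoeff_zero hv
  refine expandsIn_of_tendstoUniformlyOn_sub hexp (r := fun N => ‖cc N‖ + ‖cc (N + 1)‖) ?_ ?_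
  · simpa using hcc.norm.add ((tendsto_add_atTop_iff_nat 1).2 hcc).norm
  · filter_upwards [eventually_ge_atTop 2] with M hM x hx
    obtain ⟨N, rfl⟩ := Nat.exists_eq_add_of_le' hM
    have h4 := four_mul_sum_quad (chebCoeff_zero_eq_cosCoeff v)
      (fun n hn => chebCoeff_eq_cosCoeff v hn) (cosCoeff_sub_eq_diffCoeff huv hv) x N
    have e : ∑ n ∈ Finset.range (N + 2), chebCoeff v n * (((1 - x ^ 2) * chebT n x : ℝ) : ℂ) -
        ∑ n ∈ Finset.range (N + 2), diffCoeff u n * ((chebT (n + 2) x - chebT n x : ℝ) : ℂ) =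
        cc (N + 2) * ((-(chebT (N + 2) x - chebT N x) / 4 : ℝ) : ℂ) +
          cc (N + 3) * ((-(chebT (N + 3) x - chebT (N + 1) x) / 4 : ℝ) : ℂ) := by
      push_cast at h4 ⊢
      linear_combination h4 / 4
    have hT : ∀ n m : ℕ, |-(chebT n x - chebT m x) / 4| ≤ 1 := fun n m => by
      have h1 := abs_le.1 (abs_chebT_le_one n hx)
      have h2 := abs_le.1 (abs_chebT_le_one m hx)
      rw [abs_le]
      constructor <;> linarith
    rw [e]
    refine (norm_add_le _ _).trans (add_le_add ?_ ?_) <;>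
    · rw [norm_mul, Complex.norm_real]
      exact mul_le_of_le_one_right (norm_nonneg _) (hT _ _)

/-- A factor G that is either zero or bounded away from zero makes an error o(σ) also o(t) wherever
t does not vanish. -/
lemma simWithScale_of_isLittleO {s t σ G : ℕ → ℂ} {δ : ℝ} (hδ : 0 < δ)
    (hG : ∀ n, G n = 0 ∨ δ ≤ ‖G n‖) (ht : ∀ n, t n = G n * σ n)
    (hs : (fun n => s n - t n) =o[atTop] σ) : SimWithScale s t σ := by
  constructor
  · have hO : σ =O[atTop ⊓ 𝓟 {n | t n ≠ 0}] t := by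
      refine IsBigO.of_bound δ⁻¹ ?_
      filter_upwards [mem_inf_of_right (mem_principal_self _)] with n hn
      have hGn : G n ≠ 0 := fun h => hn (by rw [ht, h, zero_mul])
      rw [ht, norm_mul, ← div_eq_inv_mul, le_div_iff₀ hδ, mul_comm]
      exact mul_le_mul_of_nonneg_right ((hG n).resolve_left hGn) (norm_nonneg _)
    exact (hs.mono inf_le_left).trans_isBigO hO
  · refine (hs.mono inf_le_left).congr' ?_ EventuallyEq.rfl
    filter_upwards [mem_inf_of_right (mem_principal_self _)] with n hn
    rw [show t n = 0 from hn, sub_zero]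

/-! ### Asymptotics on the scale (log n)^m n^{-q} and summation of tails -/

/-- The comparison sequence `(log n)^m n^(-q)`. -/
def logPow (m q : ℝ) (x : ℝ) : ℝ := Real.log x ^ m * x ^ (-q)

lemma logPow_pos {m q x : ℝ} (hx : 1 < x) : 0 < logPow m q x :=
  mul_pos (Real.rpow_pos_of_pos (Real.log_pos hx) _) (Real.rpow_pos_of_pos (by linarith) _)

lemma hasDerivAt_logPow (m q : ℝ) {x : ℝ} (hx : 1 < x) :
    HasDerivAt (logPow m q) (logPow m (q + 1) x * (m / Real.log x - q)) x := by
  have hx0 : 0 < x := by linarith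
  have hl := Real.log_pos hx
  have h := ((Real.hasDerivAt_log hx0.ne').rpow_const (p := m) (Or.inl hl.ne')).mul
    (Real.hasDerivAt_rpow_const (p := -q) (Or.inl hx0.ne'))
  refine h.congr_deriv ?_
  rw [logPow, Real.rpow_sub hl, Real.rpow_sub hx0, neg_add, Real.rpow_add hx0,
    Real.rpow_neg hx0.le 1, Real.rpow_one, Real.rpow_one]
  field_simp
  ring

lemma tendsto_div_natCast_one {ξ : ℕ → ℝ} (h : ∀ᶠ n : ℕ in atTop, (n : ℝ) ≤ ξ n ∧ ξ n ≤ n + 2) :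
    Tendsto (fun n : ℕ => ξ n / n) atTop (𝓝 1) := by
  have h2 : Tendsto (fun n : ℕ => 1 + 2 / (n : ℝ)) atTop (𝓝 1) := by
    simpa using (tendsto_const_div_atTop_nhds_zero_nat 2).const_add (1 : ℝ)
  refine tendsto_of_tendsto_of_tendsto_of_le_of_le' tendsto_const_nhds h2 ?_ ?_
  · filter_upwards [h, eventually_gt_atTop 0] with n hn h0
    have : (0 : ℝ) < n := by exact_mod_cast h0
    rw [le_div_iff₀ this]; linarith [hn.1]
  · filter_upwards [h, eventually_gt_atTop 0] with n hn h0
    have : (0 : ℝ) < n := by exact_mod_cast h0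
    rw [div_le_iff₀ this, add_mul, div_mul_cancel₀ _ this.ne']; linarith [hn.2]

lemma tendsto_log_natCast : Tendsto (fun n : ℕ => Real.log n) atTop atTop :=
  Real.tendsto_log_atTop.comp tendsto_natCast_atTop_atTop

lemma tendsto_log_div_log_natCast {ξ : ℕ → ℝ} {r : ℝ} (hr : 0 < r)
    (h : Tendsto (fun n : ℕ => ξ n / n) atTop (𝓝 r)) :
    Tendsto (fun n : ℕ => Real.log (ξ n) / Real.log n) atTop (𝓝 1) := by
  have h1 : Tendsto (fun n : ℕ => Real.log (ξ n / n) / Real.log n + 1) atTop (𝓝 1) := by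
    simpa using ((h.log hr.ne').div_atTop tendsto_log_natCast).add_const 1
  refine h1.congr' ?_
  filter_upwards [h.eventually_const_lt hr, eventually_gt_atTop 1] with n hn h1
  have h1' : (1 : ℝ) < n := by exact_mod_cast h1
  have hξ : ξ n ≠ 0 := by rintro h; simp [h] at hn
  have hl := Real.log_pos h1'
  rw [Real.log_div hξ (by positivity)]
  field_simp
  ring

lemma tendsto_logPow_div_logPow (m q : ℝ) {ξ : ℕ → ℝ}
    (h : ∀ᶠ n : ℕ in atTop, (n : ℝ) ≤ ξ n ∧ ξ n ≤ n + 2) :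
    Tendsto (fun n : ℕ => logPow m q (ξ n) / logPow m q n) atTop (𝓝 1) := by
  have h1 := tendsto_div_natCast_one h
  have h2 := tendsto_log_div_log_natCast one_pos h1
  have h3 := (h2.rpow_const (p := m) (Or.inl one_ne_zero)).mul
    (h1.rpow_const (p := -q) (Or.inl one_ne_zero))
  simp only [Real.one_rpow, mul_one] at h3
  refine h3.congr' ?_
  filter_upwards [h, eventually_gt_atTop 1] with n hn hn1
  have h1' : (1 : ℝ) < n := by exact_mod_cast hn1
  have hξ : 1 < ξ n := h1'.trans_le hn.1
  rw [Real.div_rpow (Real.log_pos hξ).le (Real.log_pos h1').le,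
    Real.div_rpow (by linarith) (by linarith), logPow, logPow, div_mul_div_comm]

/-- Mean value theorem on [n, n+2]: the derivative is (m / log ξ - q) (log ξ)^m ξ^{-q-1}, and ξ/n →
1. -/
lemma tendsto_logPow_sub_div (m : ℝ) {q : ℝ} (hq : 0 < q) :
    Tendsto (fun n : ℕ => (logPow m q n - logPow m q (n + 2)) / (2 * q * logPow m (q + 1) n))
      atTop (𝓝 1) := by
  have hex : ∀ n : ℕ, ∃ ξ : ℝ, 1 < n → ((n : ℝ) ≤ ξ ∧ ξ ≤ n + 2) ∧
      logPow m q n - logPow m q (n + 2) =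
        2 * (logPow m (q + 1) ξ * (q - m / Real.log ξ)) := by
    intro n
    by_cases hn : 1 < n
    · have h1 : (1 : ℝ) < n := by exact_mod_cast hn
      obtain ⟨ξ, hξ, he⟩ := exists_hasDerivAt_eq_slope (logPow m q)
        (fun x => logPow m (q + 1) x * (m / Real.log x - q)) (a := (n : ℝ)) (b := n + 2)
        (by linarith)
        (fun x hx => (hasDerivAt_logPow m q (h1.trans_le hx.1)).continuousAt.continuousWithinAt)
        (fun x hx => hasDerivAt_logPow m q (h1.trans hx.1))
      refine ⟨ξ, fun _ => ⟨⟨hξ.1.le, hξ.2.le⟩, ?_⟩⟩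
      rw [add_sub_cancel_left, eq_div_iff two_ne_zero] at he
      linarith
    · exact ⟨0, fun h => absurd h hn⟩
  choose ξ hξ using hex
  have hb : ∀ᶠ n : ℕ in atTop, (n : ℝ) ≤ ξ n ∧ ξ n ≤ n + 2 :=
    (eventually_gt_atTop 1).mono fun n hn => (hξ n hn).1
  have hlog : Tendsto (fun n => Real.log (ξ n)) atTop atTop :=
    Real.tendsto_log_atTop.comp
      (tendsto_atTop_mono' _ (hb.mono fun n h => h.1) tendsto_natCast_atTop_atTop)
  have h2 : Tendsto (fun n => (q - m / Real.log (ξ n)) / q) atTop (𝓝 1) := by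
    have := ((tendsto_const_nhds (x := m)).div_atTop hlog).const_sub q |>.div_const q
    rwa [sub_zero, div_self hq.ne'] at this
  have h3 := (tendsto_logPow_div_logPow m (q + 1) hb).mul h2
  rw [one_mul] at h3
  refine h3.congr' ?_
  filter_upwards [eventually_gt_atTop 1] with n hn
  have hp := logPow_pos (m := m) (q := q + 1) (by exact_mod_cast hn : (1 : ℝ) < n)
  rw [(hξ n hn).2]
  field_simp

lemma tendsto_logPow_zero (m : ℝ) {q : ℝ} (hq : 0 < q) :
    Tendsto (fun n : ℕ => logPow m q n) atTop (𝓝 0) := by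
  have h := (isLittleO_log_rpow_rpow_atTop m hq).tendsto_div_nhds_zero.comp
    tendsto_natCast_atTop_atTop (α := ℕ)
  refine h.congr fun n => ?_
  simp only [Function.comp]
  rw [logPow, Real.rpow_neg (Nat.cast_nonneg n), div_eq_mul_inv]

/-- Discrete tail estimate: steps of size two of a null sequence `s`, compared with those of `w`. -/
lemma isLittleO_of_sub_add_two {s G : ℕ → ℂ} {w : ℕ → ℝ} (hG : ∀ n, G (n + 2) = G n)
    (hGb : ∃ B, ∀ n, ‖G n‖ ≤ B) (hs : Tendsto s atTop (𝓝 0)) (hw : Tendsto w atTop (𝓝 0))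
    (hw0 : ∀ᶠ n in atTop, 0 ≤ w n - w (n + 2))
    (h : (fun n => s n - s (n + 2) - G n * ((w n - w (n + 2) : ℝ) : ℂ)) =o[atTop]
      fun n => w n - w (n + 2)) :
    (fun n => s n - G n * (w n : ℂ)) =o[atTop] w := by
  rw [isLittleO_iff] at h ⊢
  intro ε hε
  obtain ⟨N, hN⟩ := eventually_atTop.1 ((h hε).and hw0)
  filter_upwards [eventually_ge_atTop N] with n hn
  set e : ℕ → ℂ := fun n => s n - G n * (w n : ℂ) with he
  have step : ∀ k, ‖e n - e (n + 2 * k)‖ ≤ ε * (w n - w (n + 2 * k)) := by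
    intro k
    induction k with
    | zero => simp
    | succ k ih =>
      have h1 := (hN (n + 2 * k) (by omega)).1
      rw [Real.norm_of_nonneg (hN (n + 2 * k) (by omega)).2] at h1
      have h2 : e (n + 2 * k) - e (n + 2 * (k + 1)) =
          s (n + 2 * k) - s (n + 2 * k + 2) -
            G (n + 2 * k) * ((w (n + 2 * k) - w (n + 2 * k + 2) : ℝ) : ℂ) := by
        rw [he]
        simp only [show n + 2 * (k + 1) = n + 2 * k + 2 by ring, hG]
        push_cast
        ring
      calc ‖e n - e (n + 2 * (k + 1))‖
          ≤ ‖e n - e (n + 2 * k)‖ + ‖e (n + 2 * k) - e (n + 2 * (k + 1))‖ :=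
            norm_sub_le_norm_sub_add_norm_sub _ _ _
        _ ≤ ε * (w n - w (n + 2 * k)) + ε * (w (n + 2 * k) - w (n + 2 * k + 2)) :=
            add_le_add ih (by rw [h2]; exact h1)
        _ = ε * (w n - w (n + 2 * (k + 1))) := by
            rw [show n + 2 * (k + 1) = n + 2 * k + 2 by ring]; ring
  have hsub : Tendsto (fun k : ℕ => n + 2 * k) atTop atTop :=
    tendsto_atTop_mono (fun k => show k ≤ n + 2 * k by omega) tendsto_id
  have he0 : Tendsto e atTop (𝓝 0) := by
    obtain ⟨B, hB⟩ := hGb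
    have : Tendsto (fun n => G n * (w n : ℂ)) atTop (𝓝 0) := by
      have hw' : Tendsto (fun n => B * ‖w n‖) atTop (𝓝 0) := by simpa using hw.norm.const_mul B
      refine squeeze_zero_norm (fun n => ?_) hw'
      rw [norm_mul, Complex.norm_real]
      exact mul_le_mul_of_nonneg_right (hB n) (norm_nonneg _)
    simpa [he] using hs.sub this
  have l1 := ((he0.comp hsub).const_sub (e n)).norm
  have l2 := ((hw.comp hsub).const_sub (w n)).const_mul ε
  rw [sub_zero] at l1 l2
  -- Both e and w vanish at infinity, so k → ∞ in the telescoped estimate gives ‖e n‖ ≤ ε w n.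
  exact (le_of_tendsto_of_tendsto' l1 l2 step).trans
    (mul_le_mul_of_nonneg_left (le_abs_self _) hε.le)

/-- `s n = (G n + o(1)) (log n)^m n^(-q)`. -/
def LogPowAsymp (m q : ℝ) (G s : ℕ → ℂ) : Prop :=
  (fun n => s n - G n * (logPow m q n : ℂ)) =o[atTop] fun n : ℕ => logPow m q n

lemma LogPowAsymp.const_mul {m q : ℝ} {G s : ℕ → ℂ} (h : LogPowAsymp m q G s) (c : ℂ) :
    LogPowAsymp m q (fun n => c * G n) fun n => c * s n := by
  refine (IsLittleO.const_mul_left h c).congr_left fun n => ?_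
  ring

lemma logPow_add_two_equiv (m q : ℝ) :
    (fun n : ℕ => logPow m q (n + 2)) ~[atTop] fun n : ℕ => logPow m q n := by
  have h0 : ∀ᶠ n : ℕ in atTop, logPow m q n ≠ 0 :=
    (eventually_gt_atTop 1).mono fun n hn => (logPow_pos (by exact_mod_cast hn)).ne'
  rw [isEquivalent_iff_tendsto_one h0]
  exact tendsto_logPow_div_logPow m q (Eventually.of_forall fun n => by constructor <;> linarith)

lemma LogPowAsymp.add_two {m q : ℝ} {G s : ℕ → ℂ} (h : LogPowAsymp m q G s)
    (hG : ∀ n, G (n + 2) = G n) (hGb : ∃ B, ∀ n, ‖G n‖ ≤ B) :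
    LogPowAsymp m q G fun n => s (n + 2) := by
  have he := logPow_add_two_equiv m q
  have h1 := IsLittleO.comp_tendsto h (tendsto_add_atTop_nat 2)
  simp only [Function.comp_def, Nat.cast_add, Nat.cast_ofNat, hG] at h1
  obtain ⟨B, hB⟩ := hGb
  have h2 : (fun n : ℕ => G n * ((logPow m q (n + 2) - logPow m q n : ℝ) : ℂ)) =o[atTop]
      fun n : ℕ => logPow m q n := by
    refine IsBigO.trans_isLittleO (IsBigO.of_bound B ?_) he.isLittleO
    refine Eventually.of_forall fun n => ?_
    rw [norm_mul, Complex.norm_real]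
    exact mul_le_mul_of_nonneg_right (hB n) (norm_nonneg _)
  refine ((h1.trans_isBigO he.isBigO).add h2).congr_left fun n => ?_
  push_cast
  ring

/-- As s tends to 0, it is the sum of the d_{n+2k}. Summing with step 2 halves the integral of the
tail, whence the factor 1/(2q); G has period 2 and is constant along each such sum. -/
lemma LogPowAsymp.sum_tail {m q : ℝ} (hq : 0 < q) {G s d : ℕ → ℂ}
    (hd : LogPowAsymp m (q + 1) G d) (hG : ∀ n, G (n + 2) = G n) (hGb : ∃ B, ∀ n, ‖G n‖ ≤ B)
    (hs : Tendsto s atTop (𝓝 0)) (hsd : ∀ n, s n - s (n + 2) = d n) :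
    LogPowAsymp m q (fun n => G n / (2 * q)) s := by
  have hpos : ∀ᶠ n : ℕ in atTop, 0 < logPow m (q + 1) n :=
    (eventually_gt_atTop 1).mono fun n hn => logPow_pos (by exact_mod_cast hn)
  have hlim := tendsto_logPow_sub_div m hq
  set w : ℕ → ℝ := fun n => logPow m q n / (2 * q) with hw
  have hww : ∀ n : ℕ, w n - w (n + 2) = (logPow m q n - logPow m q (n + 2)) / (2 * q) := by
    intro n
    rw [hw]
    simp only
    push_cast
    ring
  have heq : (fun n => w n - w (n + 2)) ~[atTop] fun n : ℕ => logPow m (q + 1) n := by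
    rw [isEquivalent_iff_tendsto_one (hpos.mono fun n h => h.ne')]
    refine hlim.congr fun n => ?_
    simp only [Pi.div_apply]
    rw [hww, div_div]
  have hw0 : Tendsto w atTop (𝓝 0) := by
    simpa using (tendsto_logPow_zero m hq).div_const (2 * q)
  have hnn : ∀ᶠ n in atTop, 0 ≤ w n - w (n + 2) := by
    filter_upwards [hlim.eventually_const_lt zero_lt_one, hpos] with n h1 h2
    rw [hww]
    have := (div_pos_iff_of_pos_right (by positivity)).1 h1
    positivity
  obtain ⟨B, hB⟩ := hGb
  have h2 : (fun n : ℕ => G n * ((logPow m (q + 1) n - (w n - w (n + 2)) : ℝ) : ℂ)) =o[atTop]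
      fun n : ℕ => logPow m (q + 1) n := by
    refine IsBigO.trans_isLittleO (IsBigO.of_bound B ?_) heq.isLittleO
    refine Eventually.of_forall fun n => ?_
    rw [norm_mul, Complex.norm_real]
    refine mul_le_mul_of_nonneg_right (hB n) (norm_nonneg _) |>.trans_eq ?_
    rw [← norm_neg, neg_sub]
    rfl
  have h3 := isLittleO_of_sub_add_two hG ⟨B, hB⟩ hs hw0 hnn
    (((hd.add h2).trans_isBigO heq.symm.isBigO).congr_left fun n => by
      rw [hsd]; push_cast; ring)
  refine (h3.trans_isBigO (g := w) (k := fun n : ℕ => logPow m q n) ?_).congr_left fun n => ?_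
  · refine (isBigO_const_mul_self (2 * q)⁻¹ (fun n : ℕ => logPow m q n) atTop).congr_left fun n => ?_
    rw [hw]; simp only; ring
  · rw [hw]
    push_cast
    ring

lemma slowlyVarying_log_rpow {m : ℝ} (hm : 0 ≤ m) {C : ℂ} (hC : C ≠ 0) :
    SlowlyVarying fun n => C * ((Real.log n ^ m : ℝ) : ℂ) where
  ratio r hr := by
    have h1 : Tendsto (fun n : ℕ => ((⌊r * n⌋₊ : ℕ) : ℝ) / n) atTop (𝓝 r) :=
      (tendsto_nat_floor_mul_div_atTop hr.le).comp tendsto_natCast_atTop_atTop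
    have h2 := (tendsto_log_div_log_natCast hr h1).rpow_const (p := m) (Or.inl one_ne_zero)
    rw [Real.one_rpow] at h2
    have h3 := (Complex.continuous_ofReal.tendsto 1).comp h2
    rw [Complex.ofReal_one] at h3
    refine h3.congr fun n => ?_
    simp only [Function.comp]
    rw [Real.div_rpow (Real.log_natCast_nonneg _) (Real.log_natCast_nonneg _),
      Complex.ofReal_div, mul_div_mul_left _ _ hC]
  upper ε hε := by
    refine IsLittleO.const_mul_left (.of_norm_left ?_) C
    simp only [Complex.norm_real]
    exact ((isLittleO_log_rpow_rpow_atTop m hε).comp_tendsto tendsto_natCast_atTop_atTop).norm_left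
  lower ε hε := by
    have h1 : (fun n : ℕ => (n : ℝ) ^ (-ε)) =o[atTop] fun _ => (1 : ℝ) := by
      rw [isLittleO_one_iff]
      exact (tendsto_rpow_neg_atTop hε).comp tendsto_natCast_atTop_atTop
    refine h1.trans_isBigO (IsBigO.of_bound ‖C‖⁻¹ ?_)
    filter_upwards [tendsto_log_natCast.eventually_ge_atTop 1] with n hn
    rw [norm_mul, ← mul_assoc, inv_mul_cancel₀ (norm_ne_zero_iff.2 hC), one_mul, Complex.norm_real,
      norm_one, Real.norm_of_nonneg (by positivity)]
    exact Real.one_le_rpow hn hm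

lemma LogPowAsymp.simWithScale {m q : ℝ} {G s t σ L : ℕ → ℂ} {C k : ℂ} (hC : C ≠ 0) (hk : k ≠ 0)
    {δ : ℝ} (hδ : 0 < δ) (hG : ∀ n, G n = 0 ∨ δ ≤ ‖G n‖)
    (h : LogPowAsymp m q (fun n => k * C * G n) s)
    (hL : ∀ n, L n = C * ((Real.log n ^ m : ℝ) : ℂ))
    (hσ : ∀ n : ℕ, σ n = L n / (((n : ℝ) ^ q : ℝ) : ℂ)) (ht : ∀ n, t n = k * G n * σ n) :
    SimWithScale s t σ := by
  have e : ∀ n, σ n = C * (logPow m q n : ℂ) := fun n => by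
    rw [hσ, hL, logPow, Real.rpow_neg (Nat.cast_nonneg n)]
    push_cast
    ring
  refine simWithScale_of_isLittleO (G := fun n => k * G n) (mul_pos (norm_pos_iff.2 hk) hδ)
    (fun n => ?_) ht ?_
  · rcases hG n with h0 | h0
    · left; rw [h0, mul_zero]
    · right; rw [norm_mul]; exact mul_le_mul_of_nonneg_left h0 (norm_nonneg _)
  · have hO : (fun n : ℕ => logPow m q n) =O[atTop] σ := by
      refine IsBigO.of_bound ‖C‖⁻¹ (Eventually.of_forall fun n => ?_)
      rw [e, norm_mul, ← mul_assoc, inv_mul_cancel₀ (norm_ne_zero_iff.2 hC), one_mul,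
        Complex.norm_real]
    refine (IsLittleO.trans_isBigO h hO).congr_left fun n => ?_
    rw [ht, e]
    ring

lemma LogPowAsymp.summable {m q : ℝ} (hq : 1 < q) {G s : ℕ → ℂ} (h : LogPowAsymp m q G s)
    (hGb : ∃ B, ∀ n, ‖G n‖ ≤ B) : Summable s := by
  obtain ⟨B, hB⟩ := hGb
  have h1 : s =O[atTop] fun n : ℕ => logPow m q n := by
    have h2 : (fun n => G n * (logPow m q n : ℂ)) =O[atTop] fun n : ℕ => logPow m q n := by
      refine IsBigO.of_bound B (Eventually.of_forall fun n => ?_)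
      rw [norm_mul, Complex.norm_real]
      exact mul_le_mul_of_nonneg_right (hB n) (norm_nonneg _)
    exact (h.isBigO.add h2).congr_left fun n => by ring
  -- Half of the excess q - 1 absorbs the logarithm, and the other half leaves an exponent above 1.
  have h3 : (fun n : ℕ => logPow m q n) =O[atTop] fun n : ℕ => (n : ℝ) ^ (-((1 + q) / 2)) := by
    have := ((isLittleO_log_rpow_rpow_atTop m (s := (q - 1) / 2) (by linarith)).comp_tendsto
      (tendsto_natCast_atTop_atTop (R := ℝ))).isBigO.mul
      (isBigO_refl (fun n : ℕ => (n : ℝ) ^ (-q)) atTop)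
    refine this.congr' (Eventually.of_forall fun n => rfl) ?_
    filter_upwards [eventually_gt_atTop 0] with n hn
    simp only [Function.comp]
    rw [← Real.rpow_add (by exact_mod_cast hn)]
    congr 1
    ring
  exact summable_of_isBigO_nat (Real.summable_nat_rpow.2 (by linarith)) (h1.trans h3)

/-! ### An Abelian theorem for Laplace integrals -/

lemma one_add_abs_log_le {η t : ℝ} (hη : 0 < η) (ht : 0 < t) :
    1 + |Real.log t| ≤ (1 + 1 / η) * max (t ^ η) (t ^ (-η)) := by
  have key : ∀ x : ℝ, 1 ≤ x → 1 + |Real.log x| ≤ (1 + 1 / η) * x ^ η := by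
    intro x hx
    rw [abs_of_nonneg (Real.log_nonneg hx)]
    have h1 := Real.log_le_rpow_div (by linarith : 0 ≤ x) hη
    have h2 := Real.one_le_rpow hx hη.le
    rw [add_mul, one_mul, one_div, inv_mul_eq_div]
    exact add_le_add h2 h1
  rcases le_total 1 t with h | h
  · exact (key t h).trans (mul_le_mul_of_nonneg_left (le_max_left _ _) (by positivity))
  · have := key t⁻¹ (one_le_inv_iff₀.2 ⟨ht, h⟩)
    rw [Real.log_inv, abs_neg, Real.inv_rpow ht.le, ← Real.rpow_neg ht.le] at this
    exact this.trans (mul_le_mul_of_nonneg_left (le_max_right _ _) (by positivity))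

lemma integrableOn_rpow_mul_log_mul_exp {s m : ℝ} (hs : -1 < s) (hm : 0 ≤ m) :
    MeasureTheory.IntegrableOn
      (fun t : ℝ => t ^ s * (1 + |Real.log t|) ^ m * Real.exp (-t)) (Ioi 0) := by
  -- Small enough that η m < s + 1: after t^{±η} replaces each logarithm, both Gamma integrals still
  -- converge at 0.
  set η : ℝ := (s + 1) / (2 * (m + 1)) with hη'
  have hη : 0 < η := div_pos (by linarith) (by positivity)
  have hηm : η * m < s + 1 := by
    rw [hη', div_mul_eq_mul_div, div_lt_iff₀ (by positivity)]
    nlinarith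
  have hi := ((Real.GammaIntegral_convergent (s := s + η * m + 1)
    (by have := mul_nonneg hη.le hm; linarith)).add
    (Real.GammaIntegral_convergent (s := s - η * m + 1) (by linarith))).const_mul
      ((1 + 1 / η) ^ m)
  refine hi.mono' ?_ ?_
  · refine Measurable.aestronglyMeasurable ?_
    fun_prop
  · refine (MeasureTheory.ae_restrict_mem measurableSet_Ioi).mono fun t ht => ?_
    have ht : 0 < t := ht
    rw [Real.norm_of_nonneg (by positivity)]
    have h1 : (1 + |Real.log t|) ^ m ≤ (1 + 1 / η) ^ m * (t ^ (η * m) + t ^ (-(η * m))) := by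
      refine (Real.rpow_le_rpow (by positivity) (one_add_abs_log_le hη ht) hm).trans ?_
      rw [Real.mul_rpow (by positivity) (le_max_of_le_left (by positivity))]
      refine mul_le_mul_of_nonneg_left ?_ (by positivity)
      rcases max_choice (t ^ η) (t ^ (-η)) with h | h
      · rw [h, ← Real.rpow_mul ht.le]
        exact le_add_of_nonneg_right (by positivity)
      · rw [h, ← Real.rpow_mul ht.le, neg_mul]
        exact le_add_of_nonneg_left (by positivity)
    calc t ^ s * (1 + |Real.log t|) ^ m * Real.exp (-t)
        ≤ t ^ s * ((1 + 1 / η) ^ m * (t ^ (η * m) + t ^ (-(η * m)))) * Real.exp (-t) := by gcongr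
      _ = _ := by
        simp only [Pi.add_apply]
        rw [show s + η * m + 1 - 1 = s + η * m by ring,
          show s - η * m + 1 - 1 = s + -(η * m) by ring, Real.rpow_add ht, Real.rpow_add ht]
        ring

/-- Abelian theorem for Laplace integrals with a logarithmic power, near the origin. -/
lemma tendsto_laplace_div_logPow_of_bound {s m δ B : ℝ} {c : ℂ} {q : ℝ → ℂ} (hs : -1 < s)
    (hm : 0 ≤ m) (hδ : 0 < δ) (hδ1 : δ < 1) (hq : ContinuousOn q (Ioc 0 δ))
    (hB : ∀ y ∈ Ioc 0 δ, ‖q y‖ ≤ B * (y ^ s * (-Real.log y) ^ m))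
    (hlim : Tendsto (fun y => q y / ((y ^ s * (-Real.log y) ^ m : ℝ) : ℂ)) (𝓝[>] 0) (𝓝 c)) :
    Tendsto (fun n : ℕ => (∫ y in (0 : ℝ)..δ, q y * (Real.exp (-(n * y)) : ℂ)) /
      (logPow m (s + 1) n : ℂ)) atTop (𝓝 (c * (Real.Gamma (s + 1) : ℂ))) := by
  -- The integrand after the substitution t = n y, extended by zero; pointwise it tends to c t^s
  -- e^{-t}.
  set F : ℕ → ℝ → ℂ := fun n => (Ioc 0 (n * δ)).indicator fun t =>
    q (t / n) / (logPow m s n : ℂ) * (Real.exp (-t) : ℂ) with hF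
  have hB0 : 0 ≤ B := by
    have h1 := (norm_nonneg _).trans (hB δ ⟨hδ, le_rfl⟩)
    have h2 : 0 < δ ^ s * (-Real.log δ) ^ m :=
      mul_pos (Real.rpow_pos_of_pos hδ _)
        (Real.rpow_pos_of_pos (neg_pos.2 (Real.log_neg hδ hδ1)) _)
    exact (mul_nonneg_iff_of_pos_right h2).1 h1
  have e : ∀ n : ℕ, 1 < n → (∫ y in (0 : ℝ)..δ, q y * (Real.exp (-(n * y)) : ℂ)) /
      (logPow m (s + 1) n : ℂ) = ∫ t in Ioi (0 : ℝ), F n t := by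
    intro n hn
    have hn0 : (0 : ℝ) < n := by positivity
    rw [MeasureTheory.setIntegral_indicator measurableSet_Ioc,
      inter_eq_right.2 (fun x hx => hx.1), ← intervalIntegral.integral_of_le (by positivity)]
    have h := intervalIntegral.integral_comp_mul_left (a := 0) (b := δ)
      (fun t => q (t / n) / (logPow m s n : ℂ) * (Real.exp (-t) : ℂ)) hn0.ne'
    rw [mul_zero] at h
    rw [eq_inv_smul_iff₀ hn0.ne'] at h
    rw [← h, Complex.real_smul, ← intervalIntegral.integral_div,
      ← intervalIntegral.integral_const_mul]
    congr 1
    ext y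
    rw [mul_div_cancel_left₀ _ hn0.ne', logPow, logPow, neg_add, Real.rpow_add hn0,
      Real.rpow_neg_one]
    push_cast
    have : (n : ℂ) ≠ 0 := by exact_mod_cast hn0.ne'
    field_simp
  have hGam : ∫ t in Ioi (0 : ℝ), c * ((t ^ s * Real.exp (-t) : ℝ) : ℂ) =
      c * (Real.Gamma (s + 1) : ℂ) := by
    rw [MeasureTheory.integral_const_mul, integral_complex_ofReal,
      Real.Gamma_eq_integral (by linarith)]
    congr 3
    ext t
    rw [add_sub_cancel_right, mul_comm]
  rw [← hGam]
  refine Tendsto.congr' (f₁ := fun n => ∫ t in Ioi (0 : ℝ), F n t)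
    ((eventually_gt_atTop 1).mono fun n hn => (e n hn).symm) ?_
  refine MeasureTheory.tendsto_integral_filter_of_dominated_convergence
    (fun t => B * (t ^ s * (1 + |Real.log t|) ^ m * Real.exp (-t))) ?_ ?_
    ((integrableOn_rpow_mul_log_mul_exp hs hm).const_mul B) ?_
  · filter_upwards [eventually_gt_atTop 1] with n hn
    have hn0 : (0 : ℝ) < n := by positivity
    refine MeasureTheory.AEStronglyMeasurable.mono_measure ?_ MeasureTheory.Measure.restrict_le_self
    rw [hF, aestronglyMeasurable_indicator_iff measurableSet_Ioc]
    refine ContinuousOn.aestronglyMeasurable ?_ measurableSet_Ioc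
    refine ContinuousOn.mul (ContinuousOn.div_const (hq.comp (by fun_prop) ?_) _) (by fun_prop)
    intro t ht
    exact ⟨div_pos ht.1 hn0, by rw [div_le_iff₀ hn0, mul_comm]; exact ht.2⟩
  · filter_upwards [eventually_gt_atTop 1, tendsto_log_natCast.eventually_ge_atTop 1] with n hn hl
    have hn0 : (0 : ℝ) < n := by positivity
    refine (MeasureTheory.ae_restrict_mem measurableSet_Ioi).mono fun t ht => ?_
    have ht : 0 < t := ht
    by_cases htm : t ∈ Ioc 0 (n * δ)
    · rw [hF]
      simp only [indicator_of_mem htm]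
      have hy : t / n ∈ Ioc 0 δ :=
        ⟨div_pos ht hn0, by rw [div_le_iff₀ hn0, mul_comm]; exact htm.2⟩
      have hb := hB _ hy
      have hl0 : 0 < -Real.log (t / n) := neg_pos.2 (Real.log_neg hy.1 (hy.2.trans_lt hδ1))
      have hp : 0 < logPow m s n := logPow_pos (by exact_mod_cast hn)
      rw [norm_mul, norm_div, Complex.norm_real, Complex.norm_real, Real.norm_of_nonneg hp.le,
        Real.norm_of_nonneg (Real.exp_pos _).le, ← mul_assoc]
      refine mul_le_mul_of_nonneg_right ?_ (Real.exp_pos _).le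
      rw [div_le_iff₀ hp]
      refine hb.trans ?_
      rw [mul_assoc]
      refine mul_le_mul_of_nonneg_left ?_ hB0
      -- Once log n ≥ 1, log n - log t ≤ (1 + |log t|) log n, so dividing by (log n)^m leaves a
      -- bound independent of n.
      have h1 : (-Real.log (t / n)) ^ m ≤ ((1 + |Real.log t|) * Real.log n) ^ m := by
        refine Real.rpow_le_rpow hl0.le ?_ hm
        rw [Real.log_div ht.ne' hn0.ne']
        have := neg_abs_le (Real.log t)
        have := abs_nonneg (Real.log t)
        nlinarith
      rw [logPow]
      calc (t / n) ^ s * (-Real.log (t / n)) ^ m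
          ≤ (t / n) ^ s * ((1 + |Real.log t|) * Real.log n) ^ m := by gcongr
        _ = _ := by
          rw [Real.div_rpow ht.le hn0.le, Real.mul_rpow (by positivity) (by linarith),
            Real.rpow_neg hn0.le]
          ring
    · rw [hF]
      simp only [indicator_of_notMem htm, norm_zero]
      positivity
  · refine (MeasureTheory.ae_restrict_mem measurableSet_Ioi).mono fun t ht => ?_
    have ht : 0 < t := ht
    have hy0 : Tendsto (fun n : ℕ => t / n) atTop (𝓝[>] 0) := by
      refine tendsto_nhdsWithin_iff.2 ⟨tendsto_const_div_atTop_nhds_zero_nat t, ?_⟩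
      filter_upwards [eventually_gt_atTop 0] with n hn
      exact div_pos ht (by exact_mod_cast hn)
    have h1 := hlim.comp hy0
    have h2 : Tendsto (fun n : ℕ => ((Real.log n - Real.log t) / Real.log n) ^ m) atTop (𝓝 1) := by
      have h3 : Tendsto (fun n : ℕ => 1 - Real.log t / Real.log n) atTop (𝓝 1) := by
        simpa using (tendsto_const_nhds.div_atTop tendsto_log_natCast).const_sub (1 : ℝ)
      have h4 := h3.rpow_const (p := m) (Or.inl one_ne_zero)
      rw [Real.one_rpow] at h4
      refine h4.congr' ?_
      filter_upwards [tendsto_log_natCast.eventually_ge_atTop 1] with n hn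
      rw [sub_div, div_self (by linarith)]
    have h5 := (h1.mul ((Complex.continuous_ofReal.tendsto _).comp
      (h2.mul_const (t ^ s * Real.exp (-t)))))
    rw [one_mul] at h5
    refine h5.congr' ?_
    have hev : ∀ᶠ n : ℕ in atTop, t / n ≤ δ :=
      ((tendsto_const_div_atTop_nhds_zero_nat t).eventually_lt_const hδ).mono fun n h => h.le
    filter_upwards [eventually_gt_atTop 1, hev] with n hn hnδ
    have hn0 : (0 : ℝ) < n := by positivity
    have hn1 : (1 : ℝ) < n := by exact_mod_cast hn
    have hy : t / n ∈ Ioc 0 δ := ⟨div_pos ht hn0, hnδ⟩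
    have htm : t ∈ Ioc 0 (n * δ) := ⟨ht, by rwa [div_le_iff₀ hn0, mul_comm] at hnδ⟩
    have hl0 : 0 < -Real.log (t / n) := neg_pos.2 (Real.log_neg hy.1 (hy.2.trans_lt hδ1))
    have hln := Real.log_pos hn1
    rw [hF]
    simp only [indicator_of_mem htm, Function.comp]
    have e1 : (t / n) ^ s * (-Real.log (t / n)) ^ m =
        t ^ s * ((Real.log n - Real.log t) / Real.log n) ^ m * logPow m s n := by
      have : -Real.log (t / n) = Real.log n - Real.log t := by
        rw [Real.log_div ht.ne' hn0.ne']; ring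
      rw [this] at hl0 ⊢
      rw [Real.div_rpow hl0.le hln.le, logPow, Real.div_rpow ht.le hn0.le, Real.rpow_neg hn0.le]
      have := (Real.rpow_pos_of_pos hln m).ne'
      field_simp
    have e2 : ((Real.log n - Real.log t) / Real.log n) ^ m ≠ 0 := by
      have : -Real.log (t / n) = Real.log n - Real.log t := by
        rw [Real.log_div ht.ne' hn0.ne']; ring
      rw [this] at hl0
      positivity
    have e3 := (logPow_pos (m := m) (q := s) hn1).ne'
    have e4 := (Real.rpow_pos_of_pos ht s).ne'
    rw [e1]
    push_cast
    have e2' := Complex.ofReal_ne_zero.2 e2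
    have e3' := Complex.ofReal_ne_zero.2 e3
    have e4' := Complex.ofReal_ne_zero.2 e4
    field_simp

lemma tendsto_exp_neg_div_logPow {m q δ : ℝ} (hm : 0 ≤ m) (hδ : 0 < δ) :
    Tendsto (fun n : ℕ => Real.exp (-(n * δ)) / logPow m q n) atTop (𝓝 0) := by
  have h1 : Tendsto (fun n : ℕ => (n : ℝ) ^ q * Real.exp (-δ * n)) atTop (𝓝 0) :=
    (tendsto_rpow_mul_exp_neg_mul_atTop_nhds_zero q δ hδ).comp tendsto_natCast_atTop_atTop
  refine squeeze_zero' ?_ ?_ h1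
  · filter_upwards [eventually_gt_atTop 1] with n hn
    exact div_nonneg (Real.exp_pos _).le (logPow_pos (by exact_mod_cast hn)).le
  · filter_upwards [eventually_gt_atTop 1, tendsto_log_natCast.eventually_ge_atTop 1] with n hn hl
    rw [div_le_iff₀ (logPow_pos (by exact_mod_cast hn)), logPow, neg_mul, mul_comm δ,
      show (n : ℝ) ^ q * Real.exp (-(n * δ)) * (Real.log n ^ m * (n : ℝ) ^ (-q)) =
        Real.exp (-(n * δ)) * Real.log n ^ m * ((n : ℝ) ^ q * (n : ℝ) ^ (-q)) by ring,
      ← Real.rpow_add (by positivity), add_neg_cancel, Real.rpow_zero, mul_one]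
    exact le_mul_of_one_le_right (Real.exp_pos _).le (Real.one_le_rpow hl hm)

/-- The existence of the limit bounds the quotient near 0, where the previous lemma applies; the
integral over [η, δ] is exponentially small. -/
lemma tendsto_laplace_div_logPow {s m δ : ℝ} {c : ℂ} {q : ℝ → ℂ} (hs : -1 < s)
    (hm : 0 ≤ m) (hδ : 0 < δ) (hq : ContinuousOn q (Icc 0 δ))
    (hlim : Tendsto (fun y => q y / ((y ^ s * (-Real.log y) ^ m : ℝ) : ℂ)) (𝓝[>] 0) (𝓝 c)) :
    Tendsto (fun n : ℕ => (∫ y in (0 : ℝ)..δ, q y * (Real.exp (-(n * y)) : ℂ)) /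
      (logPow m (s + 1) n : ℂ)) atTop (𝓝 (c * (Real.Gamma (s + 1) : ℂ))) := by
  have hev : ∀ᶠ y in 𝓝[>] (0 : ℝ), ‖q y / ((y ^ s * (-Real.log y) ^ m : ℝ) : ℂ)‖ ≤ ‖c‖ + 1 :=
    (hlim.norm.eventually_lt_const (lt_add_one _)).mono fun y h => h.le
  obtain ⟨ε, hε, hεq⟩ := mem_nhdsGT_iff_exists_Ioo_subset.1 hev
  have hε : 0 < ε := hε
  set η : ℝ := min (ε / 2) (min δ (1 / 2)) with hη'
  have hη : 0 < η := by positivity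
  have hηε : η < ε := (min_le_left _ _).trans_lt (by linarith)
  have hηδ : η ≤ δ := (min_le_right _ _).trans (min_le_left _ _)
  have hη1 : η < 1 := ((min_le_right _ _).trans (min_le_right _ _)).trans_lt (by norm_num)
  have hmain := tendsto_laplace_div_logPow_of_bound (B := ‖c‖ + 1) hs hm hη hη1
    (hq.mono fun y hy => ⟨hy.1.le, hy.2.trans hηδ⟩) (fun y hy => by
      have h := hεq ⟨hy.1, hy.2.trans_lt hηε⟩
      simp only [mem_ofPred_eq] at h
      have hp : 0 < y ^ s * (-Real.log y) ^ m :=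
        mul_pos (Real.rpow_pos_of_pos hy.1 _) (Real.rpow_pos_of_pos
          (neg_pos.2 (Real.log_neg hy.1 (hy.2.trans_lt hη1))) _)
      rwa [norm_div, Complex.norm_real, Real.norm_of_nonneg hp.le, div_le_iff₀ hp] at h) hlim
  obtain ⟨M, hM⟩ := isCompact_Icc.exists_bound_of_continuousOn hq
  have hint : ∀ n : ℕ, ContinuousOn (fun y : ℝ => q y * (Real.exp (-(n * y)) : ℂ)) (Icc 0 δ) :=
    fun n => hq.mul (by fun_prop)
  have hrest : Tendsto (fun n : ℕ => (∫ y in η..δ, q y * (Real.exp (-(n * y)) : ℂ)) /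
      (logPow m (s + 1) n : ℂ)) atTop (𝓝 0) := by
    have h0 := (tendsto_exp_neg_div_logPow (q := s + 1) hm hη).const_mul (M * |δ - η|)
    rw [mul_zero] at h0
    refine squeeze_zero_norm' ?_ h0
    filter_upwards [eventually_gt_atTop 1] with n hn
    have hp : 0 < logPow m (s + 1) n := logPow_pos (by exact_mod_cast hn)
    rw [norm_div, Complex.norm_real, Real.norm_of_nonneg hp.le, ← mul_div_assoc]
    refine div_le_div_of_nonneg_right ?_ hp.le
    rw [mul_right_comm]
    refine intervalIntegral.norm_integral_le_of_norm_le_const fun y hy => ?_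
    rw [uIoc_of_le hηδ] at hy
    have h1 := hM y ⟨hη.le.trans hy.1.le, hy.2⟩
    rw [norm_mul, Complex.norm_real, Real.norm_of_nonneg (Real.exp_pos _).le]
    refine mul_le_mul h1 (Real.exp_le_exp.2 ?_) (Real.exp_pos _).le ((norm_nonneg _).trans h1)
    have : (0 : ℝ) ≤ n := Nat.cast_nonneg n
    nlinarith [hy.1]
  have hsum := hmain.add hrest
  rw [add_zero] at hsum
  refine hsum.congr fun n => ?_
  rw [← add_div, intervalIntegral.integral_add_adjacent_intervals]
  · exact ((hint n).mono (Icc_subset_Icc_right hηδ)).intervalIntegrable_of_Icc hη.le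
  · exact ((hint n).mono (Icc_subset_Icc_left hη.le)).intervalIntegrable_of_Icc hηδ

/-! ### The singular kernel in the lower half plane -/

/-- The analytic continuation of `(sin z)^(2φ) (-log (sin² z))^ϑ` off the interval `(0, π/2)`. -/
def singKernel (φ ϑ : ℝ) (z : ℂ) : ℂ :=
  Complex.sin z ^ ((2 * φ : ℝ) : ℂ) * (-2 * Complex.log (Complex.sin z)) ^ (ϑ : ℂ)

lemma sin_re (z : ℂ) : (Complex.sin z).re = Real.sin z.re * Real.cosh z.im := by
  rw [Complex.sin_eq]
  simp [← Complex.ofReal_sin, ← Complex.ofReal_cosh, ← Complex.ofReal_cos, ← Complex.ofReal_sinh]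

lemma sin_im (z : ℂ) : (Complex.sin z).im = Real.cos z.re * Real.sinh z.im := by
  rw [Complex.sin_eq]
  simp [← Complex.ofReal_sin, ← Complex.ofReal_cosh, ← Complex.ofReal_cos, ← Complex.ofReal_sinh]

/-- The principal argument is continuous from above on the negative axis. The base -2 log sin z
reaches that axis on the side Re z = π/2, coming from the closed upper half plane. -/
lemma continuousOn_cpow_const_im_nonneg {ϑ : ℝ} (hϑ : 0 ≤ ϑ) :
    ContinuousOn (fun w : ℂ => w ^ (ϑ : ℂ)) {w | 0 ≤ w.im} := by
  intro w hw
  rcases hϑ.eq_or_lt with rfl | hϑ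
  · simp only [Complex.ofReal_zero, Complex.cpow_zero]
    exact continuousWithinAt_const
  by_cases hw0 : w = 0
  · subst hw0
    exact ((Complex.continuousAt_cpow_zero_of_re_pos (z := (ϑ : ℂ)) (by simpa)).comp
      (f := fun w : ℂ => (w, (ϑ : ℂ))) (by fun_prop)).continuousWithinAt
  by_cases hs : w ∈ Complex.slitPlane
  · exact (continuousAt_id.cpow continuousAt_const hs).continuousWithinAt
  · rw [Complex.mem_slitPlane_iff, not_or, not_not, not_lt] at hs
    have hre : w.re < 0 := lt_of_le_of_ne hs.1 fun h => hw0 (Complex.ext h hs.2)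
    have hlog := Complex.continuousWithinAt_log_of_re_neg_of_im_zero hre hs.2
    have hexp : ContinuousWithinAt (fun w : ℂ => Complex.exp (Complex.log w * ϑ))
        {w | 0 ≤ w.im} w := (hlog.mul_const (ϑ : ℂ)).cexp
    have hne : {w : ℂ | w ≠ 0} ∈ 𝓝[{w | 0 ≤ w.im}] w :=
      mem_nhdsWithin_of_mem_nhds (isOpen_ne.mem_nhds hw0)
    refine hexp.congr_of_eventuallyEq ?_ (Complex.cpow_def_of_ne_zero hw0 _)
    filter_upwards [hne] with w' hw'
    exact Complex.cpow_def_of_ne_zero hw' _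

lemma sin_mem_slitPlane {z : ℂ} (h0 : 0 ≤ z.re) (h1 : z.re ≤ Real.pi / 2)
    (hz : z ≠ 0) : Complex.sin z ∈ Complex.slitPlane := by
  rw [Complex.mem_slitPlane_iff, sin_re, sin_im]
  rcases h0.eq_or_lt with h | h
  · right
    rw [← h, Real.cos_zero, one_mul, Ne, Real.sinh_eq_zero]
    exact fun h' => hz (Complex.ext h.symm h')
  · left
    exact mul_pos (Real.sin_pos_of_pos_of_lt_pi h (by linarith [Real.pi_pos])) (Real.cosh_pos _)

lemma neg_two_log_sin_im (z : ℂ) :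
    (-2 * Complex.log (Complex.sin z)).im = -2 * Complex.arg (Complex.sin z) := by
  simp [Complex.log_im]

lemma neg_two_log_sin_im_nonneg {z : ℂ} (h0 : 0 ≤ z.re) (h1 : z.re ≤ Real.pi / 2) (h2 : z.im ≤ 0) :
    0 ≤ (-2 * Complex.log (Complex.sin z)).im := by
  rw [neg_two_log_sin_im]
  have hre : 0 ≤ (Complex.sin z).re := by
    rw [sin_re]
    exact mul_nonneg (Real.sin_nonneg_of_nonneg_of_le_pi h0 (by linarith [Real.pi_pos]))
      (Real.cosh_pos _).le
  have him : (Complex.sin z).im ≤ 0 := by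
    rw [sin_im]
    exact mul_nonpos_of_nonneg_of_nonpos
      (Real.cos_nonneg_of_neg_pi_div_two_le_of_le (by linarith [Real.pi_pos]) h1)
      (Real.sinh_nonpos_iff.2 h2)
  have : Complex.arg (Complex.sin z) ≤ 0 := by
    rcases him.lt_or_eq with h | h
    · exact (Complex.arg_neg_iff.2 h).le
    · rw [Complex.arg_eq_zero_iff.2 ⟨hre, h⟩]
  linarith

/-- The closed rectangle `[0, π/2] × [-δ, 0]`. -/
def lowerRect (δ : ℝ) : Set ℂ := Icc 0 (Real.pi / 2) ×ℂ Icc (-δ) 0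

/-- The logarithm is traded for an arbitrarily small negative power of |sin z|. This serves both for
continuity at 0 and for integrability of u/(1 - x²). -/
lemma norm_singKernel_le {φ ϑ η : ℝ} (hϑ : 0 ≤ ϑ) (hη : 0 < η) {z : ℂ}
    (hz : Complex.sin z ≠ 0) (hz1 : ‖Complex.sin z‖ ≤ 1) :
    ‖singKernel φ ϑ z‖ ≤ (2 * Real.pi * (1 + 1 / η)) ^ ϑ * ‖Complex.sin z‖ ^ (2 * φ - η * ϑ) := by
  set r := ‖Complex.sin z‖ with hr
  have hr0 : 0 < r := norm_pos_iff.2 hz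
  have hmax : max (r ^ η) (r ^ (-η)) = r ^ (-η) :=
    max_eq_right (Real.rpow_le_rpow_of_exponent_ge hr0 hz1 (by linarith))
  have hlog : ‖-2 * Complex.log (Complex.sin z)‖ ≤ 2 * Real.pi * (1 + 1 / η) * r ^ (-η) := by
    have h1 := one_add_abs_log_le hη hr0
    rw [hmax] at h1
    have h2 : ‖Complex.log (Complex.sin z)‖ ≤ |Real.log r| + Real.pi := by
      refine (Complex.norm_le_abs_re_add_abs_im _).trans ?_
      rw [Complex.log_re, Complex.log_im]
      exact add_le_add le_rfl (Complex.abs_arg_le_pi _)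
    have h3 : |Real.log r| + Real.pi ≤ Real.pi * (1 + |Real.log r|) := by
      nlinarith [abs_nonneg (Real.log r), Real.pi_gt_three]
    rw [norm_mul, norm_neg, Complex.norm_two]
    nlinarith [Real.pi_pos]
  rw [singKernel, norm_mul, Complex.norm_cpow_real, Complex.norm_cpow_real, ← hr]
  calc r ^ (2 * φ) * ‖-2 * Complex.log (Complex.sin z)‖ ^ ϑ
      ≤ r ^ (2 * φ) * (2 * Real.pi * (1 + 1 / η) * r ^ (-η)) ^ ϑ := by gcongr
    _ = _ := by
      rw [Real.mul_rpow (by positivity) (by positivity), ← Real.rpow_mul hr0.le,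
        show 2 * φ - η * ϑ = 2 * φ + -η * ϑ by ring, Real.rpow_add hr0]
      ring

lemma continuousOn_singKernel {φ ϑ : ℝ} (hφ : 0 < φ) (hϑ : 0 ≤ ϑ) (δ : ℝ) :
    ContinuousOn (singKernel φ ϑ) (lowerRect δ) := by
  intro z hz
  obtain ⟨⟨h0, h1⟩, -, h2⟩ := hz
  by_cases hz0 : z = 0
  · subst hz0
    have hK0 : singKernel φ ϑ 0 = 0 := by
      rw [singKernel, Complex.sin_zero, Complex.zero_cpow, zero_mul]
      exact Complex.ofReal_ne_zero.2 (by linarith)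
    rw [ContinuousWithinAt, hK0]
    -- Chosen so that the exponent 2φ - ηϑ stays positive and the bound tends to 0 at the corner.
    set η : ℝ := φ / (ϑ + 1) with hη'
    have hη : 0 < η := by positivity
    have he : 0 < 2 * φ - η * ϑ := by
      have : η * ϑ < φ + φ := by
        rw [hη', div_mul_eq_mul_div, div_lt_iff₀ (by positivity)]
        nlinarith
      linarith
    have hb : Tendsto (fun z : ℂ => (2 * Real.pi * (1 + 1 / η)) ^ ϑ *
        ‖Complex.sin z‖ ^ (2 * φ - η * ϑ)) (𝓝[lowerRect δ] 0) (𝓝 0) := by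
      have hc : ContinuousAt (fun z : ℂ => (2 * Real.pi * (1 + 1 / η)) ^ ϑ *
        ‖Complex.sin z‖ ^ (2 * φ - η * ϑ)) 0 :=
        continuousAt_const.mul
          ((by fun_prop : ContinuousAt (fun z : ℂ => ‖Complex.sin z‖) 0).rpow_const (Or.inr he.le))
      have := hc.tendsto.mono_left (nhdsWithin_le_nhds (s := lowerRect δ))
      simpa [Real.zero_rpow he.ne'] using this
    refine squeeze_zero_norm' ?_ hb
    have hn : ∀ᶠ z : ℂ in 𝓝[lowerRect δ] 0, ‖Complex.sin z‖ ≤ 1 := by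
      have hc : ContinuousAt (fun z : ℂ => ‖Complex.sin z‖) 0 := by fun_prop
      have : ‖Complex.sin 0‖ < 1 := by simp
      exact nhdsWithin_le_nhds ((hc.eventually_lt_const this).mono fun z h => h.le)
    filter_upwards [hn, self_mem_nhdsWithin] with z hz1 hzR
    by_cases hz0 : z = 0
    · subst hz0
      rw [hK0, norm_zero]
      positivity
    · exact norm_singKernel_le hϑ hη (Complex.slitPlane_ne_zero
        (sin_mem_slitPlane hzR.1.1 hzR.1.2 hz0)) hz1
  · have hs := sin_mem_slitPlane h0 h1 hz0
    have hsin : ContinuousAt Complex.sin z := Complex.continuous_sin.continuousAt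
    refine ContinuousWithinAt.mul (hsin.cpow continuousAt_const hs).continuousWithinAt ?_
    have hl : ContinuousAt (fun z => -2 * Complex.log (Complex.sin z)) z :=
      continuousAt_const.mul (hsin.clog hs)
    exact (continuousOn_cpow_const_im_nonneg hϑ _ (neg_two_log_sin_im_nonneg h0 h1 h2)).comp
      (f := fun z => -2 * Complex.log (Complex.sin z)) hl.continuousWithinAt fun w hw => neg_two_log_sin_im_nonneg hw.1.1 hw.1.2 hw.2.2

lemma differentiableAt_singKernel (φ ϑ : ℝ) {z : ℂ} (h0 : 0 < z.re) (h1 : z.re < Real.pi / 2)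
    (h2 : z.im < 0) : DifferentiableAt ℂ (singKernel φ ϑ) z := by
  have hz0 : z ≠ 0 := by rintro rfl; simp at h0
  have hs := sin_mem_slitPlane h0.le h1.le hz0
  have hsin : DifferentiableAt ℂ Complex.sin z := Complex.differentiableAt_sin
  refine (hsin.cpow (differentiableAt_const _) hs).mul ?_
  refine ((hsin.clog hs).const_mul (-2)).cpow (differentiableAt_const _) ?_
  rw [Complex.mem_slitPlane_iff]
  right
  rw [neg_two_log_sin_im]
  have him : (Complex.sin z).im < 0 := by
    rw [sin_im]
    exact mul_neg_of_pos_of_neg (Real.cos_pos_of_mem_Ioo ⟨by linarith [Real.pi_pos], h1⟩)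
      (Real.sinh_neg_iff.2 h2)
  have := Complex.arg_neg_iff.2 him
  linarith

/-! ### Contour deformation -/

lemma mem_lowerRect_bottom {δ x : ℝ} (hδ : 0 ≤ δ) (hx : x ∈ Icc 0 (Real.pi / 2)) :
    (x : ℂ) - δ * Complex.I ∈ lowerRect δ := by
  simp [lowerRect, Complex.mem_reProdIm, hx.1, hx.2, hδ]

lemma mem_lowerRect_left {δ y : ℝ} (hy : y ∈ Icc 0 δ) :
    -(y * Complex.I) ∈ lowerRect δ := by
  simp [lowerRect, Complex.mem_reProdIm, hy.1, hy.2, Real.pi_div_two_pos.le]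

lemma mem_lowerRect_right {δ y : ℝ} (hy : y ∈ Icc 0 δ) :
    ((Real.pi / 2 : ℝ) : ℂ) - y * Complex.I ∈ lowerRect δ := by
  simp only [lowerRect, Complex.mem_reProdIm, Complex.sub_re, Complex.sub_im, Complex.ofReal_re,
    Complex.ofReal_im, Complex.re_ofReal_mul, Complex.im_ofReal_mul, Complex.I_re, Complex.I_im]
  norm_num
  exact ⟨by linarith [Real.pi_pos], hy.2, hy.1⟩

lemma integral_lowerRect {F : ℂ → ℂ} {δ : ℝ} (hδ : 0 < δ) (hF : ContinuousOn F (lowerRect δ))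
    (hd : ∀ z : ℂ, 0 < z.re → z.re < Real.pi / 2 → -δ < z.im → z.im < 0 → DifferentiableAt ℂ F z) :
    ∫ x in (0 : ℝ)..(Real.pi / 2), F x =
      (∫ x in (0 : ℝ)..(Real.pi / 2), F (x - δ * Complex.I)) +
        Complex.I * (∫ y in (0 : ℝ)..δ, F (((Real.pi / 2 : ℝ) : ℂ) - y * Complex.I)) -
        Complex.I * ∫ y in (0 : ℝ)..δ, F (-(y * Complex.I)) := by
  have hpi := Real.pi_pos
  have h := Complex.integral_boundary_rect_eq_zero_of_continuousOn_of_differentiableOn F 0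
    (((Real.pi / 2 : ℝ) : ℂ) + ((-δ : ℝ) : ℂ) * Complex.I)
    (by
      simp only [Complex.zero_re, Complex.zero_im, Complex.add_re, Complex.add_im,
        Complex.ofReal_re, Complex.ofReal_im, Complex.re_ofReal_mul, Complex.im_ofReal_mul,
        Complex.I_re, Complex.I_im, mul_zero, mul_one, add_zero, zero_add]
      rwa [uIcc_of_le (by positivity), uIcc_of_ge (by linarith)])
    (by
      simp only [Complex.zero_re, Complex.zero_im, Complex.add_re, Complex.add_im,
        Complex.ofReal_re, Complex.ofReal_im, Complex.re_ofReal_mul, Complex.im_ofReal_mul,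
        Complex.I_re, Complex.I_im, mul_zero, mul_one, add_zero, zero_add]
      rw [min_eq_left (by positivity), max_eq_right (by positivity), min_eq_right (by linarith),
        max_eq_left (by linarith)]
      exact fun z hz => (hd z hz.1.1 hz.1.2 hz.2.1 hz.2.2).differentiableWithinAt)
  simp only [Complex.zero_re, Complex.zero_im, Complex.add_re, Complex.add_im,
    Complex.ofReal_re, Complex.ofReal_im, Complex.re_ofReal_mul, Complex.im_ofReal_mul,
    Complex.I_re, Complex.I_im, mul_zero, mul_one, add_zero, zero_add, smul_eq_mul] at h
  have hneg : ∀ G : ℝ → ℂ, ∫ y in (0 : ℝ)..(-δ), G y = -∫ y in (0 : ℝ)..δ, G (-y) := by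
    intro G
    rw [intervalIntegral.integral_comp_neg, neg_zero, ← intervalIntegral.integral_symm]
  rw [hneg, hneg] at h
  simp only [Complex.ofReal_neg, Complex.ofReal_zero, zero_mul, add_zero, neg_mul,
    ← sub_eq_add_neg, zero_sub] at h
  linear_combination h

/-- Deformation of the contour of an oscillatory integral into the lower half plane. -/
lemma integral_mul_exp_deform {F : ℂ → ℂ} {δ : ℝ} (hδ : 0 < δ)
    (hF : ContinuousOn F (lowerRect δ))
    (hd : ∀ z : ℂ, 0 < z.re → z.re < Real.pi / 2 → -δ < z.im → z.im < 0 →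
      DifferentiableAt ℂ F z) :
    ∃ (M : ℝ) (E : ℕ → ℂ), (∀ n : ℕ, ‖E n‖ ≤ M * Real.exp (-(n * δ))) ∧ ∀ n : ℕ,
      ∫ x in (0 : ℝ)..(Real.pi / 2), F x * Complex.exp (-(n * x * Complex.I)) =
        E n + Complex.I * (-Complex.I) ^ n *
          (∫ y in (0 : ℝ)..δ, F (((Real.pi / 2 : ℝ) : ℂ) - y * Complex.I) *
            (Real.exp (-(n * y)) : ℂ)) -
          Complex.I * ∫ y in (0 : ℝ)..δ, F (-(y * Complex.I)) * (Real.exp (-(n * y)) : ℂ) := by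
  have hcomp : IsCompact (lowerRect δ) := isCompact_Icc.reProdIm isCompact_Icc
  obtain ⟨M, hM⟩ := hcomp.exists_bound_of_continuousOn hF
  refine ⟨M * |Real.pi / 2 - 0|, fun n => ∫ x in (0 : ℝ)..(Real.pi / 2), F (x - δ * Complex.I) *
    Complex.exp (-(n * (x - δ * Complex.I) * Complex.I)), fun n => ?_, fun n => ?_⟩
  · rw [mul_right_comm]
    refine intervalIntegral.norm_integral_le_of_norm_le_const fun x hx => ?_
    rw [uIoc_of_le (by positivity)] at hx
    have h1 := hM _ (mem_lowerRect_bottom hδ.le ⟨hx.1.le, hx.2⟩)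
    rw [norm_mul, Complex.norm_exp]
    refine mul_le_mul h1 (Real.exp_le_exp.2 ?_) (Real.exp_pos _).le ((norm_nonneg _).trans h1)
    simp
  · rw [integral_lowerRect hδ (F := fun z => F z * Complex.exp (-(n * z * Complex.I)))
      (hF.mul (by fun_prop)) (fun z h0 h1 h2 h3 => (hd z h0 h1 h2 h3).mul (by fun_prop))]
    have e1 : ∀ y : ℝ, Complex.exp (-(n * (((Real.pi / 2 : ℝ) : ℂ) - y * Complex.I) * Complex.I)) =
        (-Complex.I) ^ n * (Real.exp (-(n * y)) : ℂ) := by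
      intro y
      rw [← Complex.exp_neg_pi_div_two_mul_I, ← Complex.exp_nat_mul, Complex.ofReal_exp,
        ← Complex.exp_add]
      congr 1
      push_cast
      linear_combination ((n : ℂ) * y) * Complex.I_mul_I
    have e2 : ∀ y : ℝ, Complex.exp (-(n * (-(y * Complex.I)) * Complex.I)) =
        (Real.exp (-(n * y)) : ℂ) := by
      intro y
      rw [Complex.ofReal_exp]
      congr 1
      push_cast
      linear_combination ((n : ℂ) * y) * Complex.I_mul_I
    simp only [e1, e2]
    simp only [mul_left_comm _ ((-Complex.I) ^ n)]
    rw [intervalIntegral.integral_const_mul, mul_assoc]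

/-! ### The imaginary part of the kernel on the vertical sides -/

lemma mul_cpow_ofReal_im (z w : ℂ) (a b : ℝ) :
    (z ^ (a : ℂ) * w ^ (b : ℂ)).im =
      ‖z‖ ^ a * ‖w‖ ^ b * Real.sin (Complex.arg z * a + Complex.arg w * b) := by
  rw [Complex.cpow_ofReal, Complex.cpow_ofReal, Real.sin_add]
  simp only [Complex.mul_im, Complex.mul_re, Complex.add_re, Complex.add_im, Complex.ofReal_re,
    Complex.ofReal_im, Complex.I_re, Complex.I_im]
  ring

/-- Here sin(-iy) = -i sinh y has argument -π/2, so the power contributes the phase -φπ and the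
logarithm acquires the imaginary part π. -/
lemma singKernel_left_im (φ ϑ : ℝ) {y : ℝ} (hy : 0 < y) :
    (singKernel φ ϑ (-(y * Complex.I))).im =
      Real.sinh y ^ (2 * φ) *
        ‖((-2 * Real.log (Real.sinh y) : ℝ) : ℂ) + Real.pi * Complex.I‖ ^ ϑ *
        Real.sin (Complex.arg (((-2 * Real.log (Real.sinh y) : ℝ) : ℂ) + Real.pi * Complex.I) * ϑ -
          φ * Real.pi) := by
  have hs : 0 < Real.sinh y := Real.sinh_pos_iff.2 hy
  have e1 : Complex.sin (-(y * Complex.I)) = (Real.sinh y : ℂ) * -Complex.I := by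
    rw [Complex.sin_neg, Complex.sin_mul_I, Complex.ofReal_sinh]
    ring
  have harg : Complex.arg ((Real.sinh y : ℂ) * -Complex.I) = -(Real.pi / 2) := by
    rw [Complex.arg_real_mul _ hs, Complex.arg_neg_I]
  have hnorm : ‖(Real.sinh y : ℂ) * -Complex.I‖ = Real.sinh y := by
    rw [norm_mul, norm_neg, Complex.norm_I, mul_one, Complex.norm_real,
      Real.norm_of_nonneg hs.le]
  have e2 : -2 * Complex.log ((Real.sinh y : ℂ) * -Complex.I) =
      ((-2 * Real.log (Real.sinh y) : ℝ) : ℂ) + Real.pi * Complex.I := by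
    rw [Complex.log, harg, hnorm]
    push_cast
    ring
  rw [singKernel, e1, e2, mul_cpow_ofReal_im, hnorm, harg]
  congr 2
  ring

/-- Here sin z = cosh y > 1, so the base of the ϑ-th power is negative with argument π. -/
lemma singKernel_right_im (φ ϑ : ℝ) {y : ℝ} (hy : 0 < y) :
    (singKernel φ ϑ (((Real.pi / 2 : ℝ) : ℂ) - y * Complex.I)).im =
      Real.cosh y ^ (2 * φ) * (2 * Real.log (Real.cosh y)) ^ ϑ * Real.sin (ϑ * Real.pi) := by
  have hc : 0 < Real.cosh y := Real.cosh_pos y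
  have hl : 0 < 2 * Real.log (Real.cosh y) :=
    mul_pos two_pos (Real.log_pos (Real.one_lt_cosh.2 hy.ne'))
  have e1 : Complex.sin (((Real.pi / 2 : ℝ) : ℂ) - y * Complex.I) = (Real.cosh y : ℂ) := by
    push_cast
    rw [Complex.sin_pi_div_two_sub, Complex.cos_mul_I]
  have e2 : -2 * Complex.log (Real.cosh y : ℂ) = ((-(2 * Real.log (Real.cosh y)) : ℝ) : ℂ) := by
    rw [← Complex.ofReal_log hc.le]
    push_cast
    ring
  rw [singKernel, e1, e2, mul_cpow_ofReal_im, Complex.arg_ofReal_of_nonneg hc.le,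
    Complex.arg_ofReal_of_neg (neg_lt_zero.2 hl), Complex.norm_real, Complex.norm_real, norm_neg,
    Real.norm_of_nonneg hc.le, Real.norm_of_nonneg hl.le]
  congr 2
  ring

lemma tendsto_sinh_div : Tendsto (fun y => Real.sinh y / y) (𝓝[>] 0) (𝓝 1) := by
  have h := (Real.hasDerivAt_sinh 0).tendsto_slope_zero_right
  simp only [Real.sinh_zero, Real.cosh_zero, zero_add, sub_zero, smul_eq_mul] at h
  exact h.congr fun y => by rw [inv_mul_eq_div]

lemma tendsto_neg_log : Tendsto (fun y => -Real.log y) (𝓝[>] 0) atTop :=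
  tendsto_neg_atBot_atTop.comp Real.tendsto_log_nhdsGT_zero

lemma tendsto_log_sinh_div :
    Tendsto (fun y => -2 * Real.log (Real.sinh y) / -Real.log y) (𝓝[>] 0) (𝓝 2) := by
  have h1 : Tendsto (fun y => 2 + -2 * Real.log (Real.sinh y / y) / -Real.log y) (𝓝[>] 0)
      (𝓝 2) := by
    simpa using (((tendsto_sinh_div.log one_ne_zero).const_mul (-2)).div_atTop
      tendsto_neg_log).const_add 2
  refine h1.congr' ?_
  filter_upwards [self_mem_nhdsWithin, tendsto_neg_log.eventually_gt_atTop 0] with y hy hl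
  have hy : 0 < y := hy
  have hl' : Real.log y ≠ 0 := by linarith
  rw [Real.log_div (Real.sinh_pos_iff.2 hy).ne' hy.ne']
  field_simp
  ring

/-- The modulus of `-2 log (sinh y) + π i`. -/
def logNorm (y : ℝ) : ℝ := ‖((-2 * Real.log (Real.sinh y) : ℝ) : ℂ) + Real.pi * Complex.I‖

lemma tendsto_log_sinh_atTop :
    Tendsto (fun y => -2 * Real.log (Real.sinh y)) (𝓝[>] 0) atTop := by
  have := tendsto_log_sinh_div.pos_mul_atTop two_pos tendsto_neg_log
  refine this.congr' ?_
  filter_upwards [tendsto_neg_log.eventually_gt_atTop 0] with y hl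
  rw [div_mul_cancel₀ _ hl.ne']

lemma tendsto_logNorm_div : Tendsto (fun y => logNorm y / -Real.log y) (𝓝[>] 0) (𝓝 2) := by
  have h2 : Tendsto (fun y => -2 * Real.log (Real.sinh y) / -Real.log y + Real.pi / -Real.log y)
      (𝓝[>] 0) (𝓝 2) := by
    simpa using tendsto_log_sinh_div.add (tendsto_const_nhds.div_atTop tendsto_neg_log)
  refine tendsto_of_tendsto_of_tendsto_of_le_of_le' tendsto_log_sinh_div h2 ?_ ?_
  · filter_upwards [tendsto_neg_log.eventually_gt_atTop 0] with y hl
    refine div_le_div_of_nonneg_right ?_ hl.le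
    have := Complex.re_le_norm (((-2 * Real.log (Real.sinh y) : ℝ) : ℂ) + Real.pi * Complex.I)
    simpa [logNorm] using this
  · filter_upwards [tendsto_neg_log.eventually_gt_atTop 0,
      tendsto_log_sinh_atTop.eventually_ge_atTop 0] with y hl hl2
    rw [← add_div]
    refine div_le_div_of_nonneg_right ?_ hl.le
    refine (norm_add_le _ _).trans_eq ?_
    rw [Complex.norm_real, Real.norm_of_nonneg hl2, norm_mul, Complex.norm_I, Complex.norm_real,
      Real.norm_of_nonneg Real.pi_pos.le, mul_one]

lemma tendsto_logNorm_atTop : Tendsto logNorm (𝓝[>] 0) atTop := by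
  have := tendsto_logNorm_div.pos_mul_atTop two_pos tendsto_neg_log
  refine this.congr' ?_
  filter_upwards [tendsto_neg_log.eventually_gt_atTop 0] with y hl
  rw [div_mul_cancel₀ _ hl.ne']

lemma arg_eq_arcsin_logNorm : ∀ᶠ y in 𝓝[>] (0 : ℝ),
    Complex.arg (((-2 * Real.log (Real.sinh y) : ℝ) : ℂ) + Real.pi * Complex.I) =
      Real.arcsin (Real.pi / logNorm y) := by
  filter_upwards [tendsto_log_sinh_atTop.eventually_ge_atTop 0] with y hl
  rw [Complex.arg_of_re_nonneg (by simpa using hl), logNorm]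
  simp

lemma tendsto_arg_zero : Tendsto (fun y => Real.arcsin (Real.pi / logNorm y)) (𝓝[>] 0) (𝓝 0) := by
  have := (Real.continuous_arcsin.tendsto 0).comp
    ((tendsto_const_nhds (x := Real.pi)).div_atTop tendsto_logNorm_atTop)
  rwa [Real.arcsin_zero] at this

/-- The derivative of sin(ϑ arcsin t) at t = 0, taken along t = π / `logNorm`. -/
lemma tendsto_logNorm_mul_sin_arg (ϑ : ℝ) :
    Tendsto (fun y => logNorm y * Real.sin (Real.arcsin (Real.pi / logNorm y) * ϑ)) (𝓝[>] 0)
      (𝓝 (Real.pi * ϑ)) := by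
  have hd : HasDerivAt (fun t => Real.sin (Real.arcsin t * ϑ)) ϑ 0 := by
    have h1 := ((Real.hasDerivAt_arcsin (x := 0) (by norm_num) (by norm_num)).mul_const ϑ).sin
    simpa using h1
  have hs := hd.tendsto_slope_zero_right
  simp only [Real.arcsin_zero, zero_mul, Real.sin_zero, zero_add, sub_zero, smul_eq_mul] at hs
  have ht : Tendsto (fun y => Real.pi / logNorm y) (𝓝[>] 0) (𝓝[>] 0) := by
    refine tendsto_nhdsWithin_iff.2
      ⟨(tendsto_const_nhds (x := Real.pi)).div_atTop tendsto_logNorm_atTop, ?_⟩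
    filter_upwards [tendsto_logNorm_atTop.eventually_gt_atTop 0] with y hy
    exact div_pos Real.pi_pos hy
  refine ((hs.comp ht).const_mul Real.pi).congr' ?_
  filter_upwards [tendsto_logNorm_atTop.eventually_gt_atTop 0] with y hy
  simp only [Function.comp]
  have := Real.pi_pos
  field_simp

lemma tendsto_singKernel_left_aux (φ ϑ : ℝ) :
    Tendsto (fun y => (Real.sinh y / y) ^ (2 * φ) * (logNorm y / -Real.log y) ^ ϑ) (𝓝[>] 0)
      (𝓝 (2 ^ ϑ)) := by
  simpa using (tendsto_sinh_div.rpow_const (p := 2 * φ) (Or.inl one_ne_zero)).mul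
    (tendsto_logNorm_div.rpow_const (p := ϑ) (Or.inl two_ne_zero))

lemma tendsto_singKernel_left (φ ϑ : ℝ) :
    Tendsto (fun y : ℝ => (singKernel φ ϑ (-(y * Complex.I))).im /
      (y ^ (2 * φ) * (-Real.log y) ^ ϑ)) (𝓝[>] 0) (𝓝 (2 ^ ϑ * Real.sin (-(φ * Real.pi)))) := by
  have h1 : Tendsto (fun y => Real.sin (Real.arcsin (Real.pi / logNorm y) * ϑ - φ * Real.pi))
      (𝓝[>] 0) (𝓝 (Real.sin (-(φ * Real.pi)))) := by
    have := (Real.continuous_sin.tendsto _).comp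
      ((tendsto_arg_zero.mul_const ϑ).sub_const (φ * Real.pi))
    rwa [zero_mul, zero_sub] at this
  refine ((tendsto_singKernel_left_aux φ ϑ).mul h1).congr' ?_
  filter_upwards [self_mem_nhdsWithin, arg_eq_arcsin_logNorm,
    tendsto_neg_log.eventually_gt_atTop 0, tendsto_logNorm_atTop.eventually_gt_atTop 0]
    with y hy ha hl hN
  have hy : 0 < y := hy
  rw [singKernel_left_im φ ϑ hy, ha, ← logNorm, Real.div_rpow (Real.sinh_pos_iff.2 hy).le hy.le,
    Real.div_rpow hN.le hl.le]
  ring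

/-- For φ = N the phase Nπ only contributes a sign. The remaining sine of ϑ times the argument is
asymptotic to πϑ / (-2 log y), which costs one power of the logarithm. -/
lemma tendsto_singKernel_left_nat (N : ℕ) (ϑ : ℝ) :
    Tendsto (fun y : ℝ => (singKernel N ϑ (-(y * Complex.I))).im /
      (y ^ (2 * (N : ℝ)) * (-Real.log y) ^ (ϑ - 1))) (𝓝[>] 0)
      (𝓝 (2 ^ ϑ * ((-1) ^ N * (2⁻¹ * (Real.pi * ϑ))))) := by
  have h1 := (tendsto_logNorm_div.inv₀ two_ne_zero).mul (tendsto_logNorm_mul_sin_arg ϑ)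
    |>.const_mul ((-1 : ℝ) ^ N)
  refine ((tendsto_singKernel_left_aux N ϑ).mul h1).congr' ?_
  filter_upwards [self_mem_nhdsWithin, arg_eq_arcsin_logNorm,
    tendsto_neg_log.eventually_gt_atTop 0, tendsto_logNorm_atTop.eventually_gt_atTop 0]
    with y hy ha hl hN
  have hy : 0 < y := hy
  rw [singKernel_left_im _ ϑ hy, ha, ← logNorm, Real.sin_sub_nat_mul_pi,
    Real.div_rpow (Real.sinh_pos_iff.2 hy).le hy.le, Real.div_rpow hN.le hl.le,
    Real.rpow_sub_one hl.ne']
  have := Real.rpow_pos_of_pos hl ϑ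
  have := Real.rpow_pos_of_pos hy (2 * N)
  have hl' : Real.log y ≠ 0 := by linarith
  field_simp

/-- For integral ϑ the factor sin(ϑπ) is zero. Otherwise 2 log cosh y ≤ y² gives the order y^{2ϑ};
when ϑ = φ a positive power of the logarithm is needed to win. -/
lemma tendsto_singKernel_right {φ ϑ m : ℝ} (hm : 0 ≤ m)
    (h : (∃ k : ℕ, ϑ = k) ∨ φ < ϑ ∨ (φ = ϑ ∧ 0 < m)) (hϑ : 0 ≤ ϑ) :
    Tendsto (fun y : ℝ => (singKernel φ ϑ (((Real.pi / 2 : ℝ) : ℂ) - y * Complex.I)).im /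
      (y ^ (2 * φ) * (-Real.log y) ^ m)) (𝓝[>] 0) (𝓝 0) := by
  rcases h with ⟨k, rfl⟩ | h
  · refine tendsto_const_nhds.congr' ?_
    filter_upwards [self_mem_nhdsWithin] with y hy
    rw [singKernel_right_im φ k hy, Real.sin_nat_mul_pi, mul_zero, zero_div]
  · have hc : Tendsto (fun y => Real.cosh y ^ (2 * φ)) (𝓝[>] 0) (𝓝 1) := by
      have : ContinuousAt (fun y => Real.cosh y ^ (2 * φ)) 0 :=
        Real.continuous_cosh.continuousAt.rpow_const (Or.inl (Real.cosh_pos 0).ne')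
      simpa using this.tendsto.mono_left (nhdsWithin_le_nhds (s := Ioi 0))
    have hy0 : Tendsto (fun y : ℝ => y) (𝓝[>] 0) (𝓝 0) := tendsto_id.mono_left nhdsWithin_le_nhds
    have hmain : Tendsto (fun y : ℝ => y ^ (2 * (ϑ - φ)) * (-Real.log y) ^ (-m)) (𝓝[>] 0)
        (𝓝 0) := by
      rcases h with h | ⟨rfl, hm0⟩
      · have h1 : Tendsto (fun y : ℝ => y ^ (2 * (ϑ - φ))) (𝓝[>] 0) (𝓝 0) := by
          have := hy0.rpow_const (p := 2 * (ϑ - φ)) (Or.inr (by linarith))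
          rwa [Real.zero_rpow (by linarith)] at this
        refine squeeze_zero' ?_ ?_ h1
        · filter_upwards [self_mem_nhdsWithin, tendsto_neg_log.eventually_gt_atTop 0] with y hy hl
          have hy : 0 < y := hy
          positivity
        · filter_upwards [self_mem_nhdsWithin, tendsto_neg_log.eventually_ge_atTop 1] with y hy hl
          have hy : 0 < y := hy
          exact mul_le_of_le_one_right (by positivity)
            (Real.rpow_le_one_of_one_le_of_nonpos hl (by linarith))
      · simpa [Function.comp_def] using (tendsto_rpow_neg_atTop hm0).comp tendsto_neg_log
    have hbound := hc.mul hmain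
    rw [mul_zero] at hbound
    refine squeeze_zero_norm' ?_ hbound
    filter_upwards [self_mem_nhdsWithin, tendsto_neg_log.eventually_gt_atTop 0] with y hy hl
    have hy : 0 < y := hy
    have hlc : 0 ≤ 2 * Real.log (Real.cosh y) :=
      mul_nonneg two_pos.le (Real.log_nonneg (Real.one_le_cosh y))
    have hle : 2 * Real.log (Real.cosh y) ≤ y ^ 2 := by
      have := Real.log_le_log (Real.cosh_pos y) (Real.cosh_le_exp_half_sq y)
      rw [Real.log_exp] at this
      linarith
    have hden : 0 < y ^ (2 * φ) * (-Real.log y) ^ m := by positivity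
    have hcy := Real.cosh_pos y
    rw [singKernel_right_im φ ϑ hy, norm_div, Real.norm_of_nonneg hden.le, norm_mul,
      Real.norm_of_nonneg (by positivity)]
    calc Real.cosh y ^ (2 * φ) * (2 * Real.log (Real.cosh y)) ^ ϑ * ‖Real.sin (ϑ * Real.pi)‖ /
          (y ^ (2 * φ) * (-Real.log y) ^ m)
        ≤ Real.cosh y ^ (2 * φ) * (y ^ 2) ^ ϑ * 1 / (y ^ (2 * φ) * (-Real.log y) ^ m) := by
          gcongr
          exact Real.abs_sin_le_one _
      _ = _ := by
          rw [← Real.rpow_natCast y 2, ← Real.rpow_mul hy.le, Real.rpow_neg hl.le, mul_sub,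
            Real.rpow_sub hy]
          push_cast
          field_simp

/-- Behaviour of the imaginary part of the kernel on the two vertical sides, at the real axis. -/
lemma exists_singKernel_im_asymptotics {φ ϑ : ℝ} (hφ : 0 < φ) (hϑ : 0 ≤ ϑ)
    (hsing : ϑ = 0 → ∀ m : ℕ, φ ≠ m) (hlog : (∃ k : ℕ, ϑ = k) ∨ φ ≤ ϑ) :
    ∃ m κ : ℝ, 0 ≤ m ∧ κ ≠ 0 ∧
      Tendsto (fun y : ℝ => (singKernel φ ϑ (-(y * Complex.I))).im /
        (y ^ (2 * φ) * (-Real.log y) ^ m)) (𝓝[>] 0) (𝓝 κ) ∧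
      Tendsto (fun y : ℝ => (singKernel φ ϑ (((Real.pi / 2 : ℝ) : ℂ) - y * Complex.I)).im /
        (y ^ (2 * φ) * (-Real.log y) ^ m)) (𝓝[>] 0) (𝓝 0) := by
  by_cases hint : ∃ N : ℕ, φ = N
  · obtain ⟨N, rfl⟩ := hint
    have hϑ0 : 0 < ϑ := lt_of_le_of_ne hϑ fun h => hsing h.symm N rfl
    have hN1 : (1 : ℝ) ≤ N := by
      have : 0 < N := by exact_mod_cast hφ
      exact_mod_cast this
    -- The lost logarithm leaves the exponent ϑ - 1, which the Laplace lemma requires to be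
    -- nonnegative.
    have hϑ1 : 1 ≤ ϑ := by
      rcases hlog with ⟨k, rfl⟩ | h
      · have : 0 < k := by exact_mod_cast hϑ0
        exact_mod_cast this
      · exact hN1.trans h
    refine ⟨ϑ - 1, _, by linarith, ?_, tendsto_singKernel_left_nat N ϑ,
      tendsto_singKernel_right (by linarith) ?_ hϑ⟩
    · have := Real.pi_pos
      have := Real.rpow_pos_of_pos two_pos ϑ
      have h1 : ((-1 : ℝ) ^ N) ≠ 0 := pow_ne_zero _ (by norm_num)
      positivity
    · rcases hlog with h | h
      · exact Or.inl h
      · rcases h.lt_or_eq with h | h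
        · exact Or.inr (Or.inl h)
        · exact Or.inl ⟨N, h.symm⟩
  · refine ⟨ϑ, _, hϑ, ?_, tendsto_singKernel_left φ ϑ, tendsto_singKernel_right hϑ ?_ hϑ⟩
    · refine mul_ne_zero (Real.rpow_pos_of_pos two_pos ϑ).ne' ?_
      rw [Real.sin_neg, neg_ne_zero, Ne, Real.sin_eq_zero_iff]
      rintro ⟨n, hn⟩
      have hn' : (n : ℝ) = φ := mul_right_cancel₀ Real.pi_ne_zero hn
      have hn0 : 0 < n := by rw [← hn'] at hφ; exact_mod_cast hφ
      refine hint ⟨n.toNat, ?_⟩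
      rw [← hn']
      have := Int.toNat_of_nonneg hn0.le
      exact_mod_cast this.symm
    · rcases hlog with h | h
      · exact Or.inl h
      · rcases h.lt_or_eq with h | h
        · exact Or.inr (Or.inl h)
        · exact Or.inr (Or.inr ⟨h, h ▸ hφ⟩)

/-! ### Reduction of the cosine integral to two Laplace integrals -/

lemma singKernel_ofReal (φ ϑ : ℝ) {x : ℝ} (hx : x ∈ Icc 0 (Real.pi / 2)) :
    singKernel φ ϑ x =
      ((Real.sin x ^ (2 * φ) * (-2 * Real.log (Real.sin x)) ^ ϑ : ℝ) : ℂ) := by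
  have hs : 0 ≤ Real.sin x :=
    Real.sin_nonneg_of_nonneg_of_le_pi hx.1 (by linarith [hx.2, Real.pi_pos])
  have hl : 0 ≤ -2 * Real.log (Real.sin x) := by
    have := Real.log_nonpos hs (Real.sin_le_one x)
    linarith
  rw [Complex.ofReal_mul, Complex.ofReal_cpow hs, Complex.ofReal_cpow hl, singKernel,
    ← Complex.ofReal_sin, ← Complex.ofReal_log hs]
  push_cast
  rfl

lemma conj_singKernel_ofReal (φ ϑ : ℝ) {x : ℝ} (hx : x ∈ Icc 0 (Real.pi / 2)) :
    conj (singKernel φ ϑ x) = singKernel φ ϑ x := by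
  rw [singKernel_ofReal φ ϑ hx, Complex.conj_ofReal]

lemma ofReal_mem_lowerRect {x δ : ℝ} (hδ : 0 ≤ δ) (hx : x ∈ Icc 0 (Real.pi / 2)) :
    (x : ℂ) ∈ lowerRect δ := by
  simp [lowerRect, Complex.mem_reProdIm, hx.1, hx.2, hδ]

lemma intervalIntegral_conj {f : ℝ → ℂ} {a b : ℝ} :
    ∫ x in a..b, conj (f x) = conj (∫ x in a..b, f x) := by
  simp only [intervalIntegral, map_sub, integral_conj]

/-- K is real on the segment, so conjugation reverses the frequency and replaces H by the
holomorphic z ↦ conj H(conj z); both exponentials can then be deformed downwards. -/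
lemma integral_mul_exp_eq_conj {H : ℂ → ℂ} (φ ϑ : ℝ) (n : ℕ) :
    ∫ x in (0 : ℝ)..(Real.pi / 2), H x * singKernel φ ϑ x * Complex.exp (n * x * Complex.I) =
      conj (∫ x in (0 : ℝ)..(Real.pi / 2), conj (H (conj (x : ℂ))) * singKernel φ ϑ x *
        Complex.exp (-(n * x * Complex.I))) := by
  rw [← intervalIntegral_conj]
  refine intervalIntegral.integral_congr fun x hx => ?_
  rw [uIcc_of_le Real.pi_div_two_pos.le] at hx
  simp only [map_mul, Complex.conj_conj, Complex.conj_ofReal, conj_singKernel_ofReal φ ϑ hx,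
    ← Complex.exp_conj, map_neg, Complex.conj_I, Complex.conj_natCast]
  ring_nf

lemma sub_conj_eq (z : ℂ) : z - conj z = 2 * Complex.I * (z.im : ℂ) := by
  rw [Complex.sub_conj]
  push_cast
  ring

/-- The hypotheses say that `H` is holomorphic near the rectangle and has the symmetries of
`z ↦ h (cos z)` with `h (-w) = (-1)^n h w`. -/
lemma integral_mul_cos_deform {φ ϑ : ℝ} (hφ : 0 < φ) (hϑ : 0 ≤ ϑ) {H : ℂ → ℂ} {δ : ℝ} (hδ : 0 < δ)
    (hH : ∀ z : ℂ, z.re ∈ Icc 0 (Real.pi / 2) → |z.im| ≤ δ → DifferentiableAt ℂ H z)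
    (heven : ∀ z, H (-z) = H z) {σ : ℂ} (hrefl : ∀ z, H (Real.pi - z) = σ * H z) :
    ∃ (M : ℝ) (E : ℕ → ℂ), (∀ n : ℕ, ‖E n‖ ≤ M * Real.exp (-(n * δ))) ∧
      ∀ n : ℕ, (-1) ^ n = σ →
      ∫ x in (0 : ℝ)..(Real.pi / 2), H x * singKernel φ ϑ x * ((Real.cos (n * x) : ℝ) : ℂ) =
        E n - (-Complex.I) ^ n *
          (∫ y in (0 : ℝ)..δ, H (((Real.pi / 2 : ℝ) : ℂ) - y * Complex.I) *
            ((singKernel φ ϑ (((Real.pi / 2 : ℝ) : ℂ) - y * Complex.I)).im : ℂ) *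
            (Real.exp (-(n * y)) : ℂ)) +
          ∫ y in (0 : ℝ)..δ, H (-(y * Complex.I)) *
            ((singKernel φ ϑ (-(y * Complex.I))).im : ℂ) * (Real.exp (-(n * y)) : ℂ) := by
  have hK := continuousOn_singKernel hφ hϑ δ
  have hHc : ContinuousOn H (lowerRect δ) := fun z hz =>
    (hH z hz.1 (abs_le.2 ⟨hz.2.1, hz.2.2.trans hδ.le⟩)).continuousAt.continuousWithinAt
  have hH' : ∀ z : ℂ, z.re ∈ Icc 0 (Real.pi / 2) → |z.im| ≤ δ →
      DifferentiableAt ℂ (fun z => conj (H (conj z))) z := fun z h1 h2 =>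
    differentiableAt_conj_conj_iff.2 (hH _ (by simpa using h1) (by simpa using h2))
  have hHc' : ContinuousOn (fun z => conj (H (conj z))) (lowerRect δ) := fun z hz =>
    (hH' z hz.1 (abs_le.2 ⟨hz.2.1, hz.2.2.trans hδ.le⟩)).continuousAt.continuousWithinAt
  obtain ⟨M₁, E₁, hE₁, h₁⟩ := integral_mul_exp_deform hδ (hHc.mul hK) fun z a b c d =>
    (hH z ⟨a.le, b.le⟩ (abs_le.2 ⟨c.le, by linarith⟩)).mul (differentiableAt_singKernel φ ϑ a b d)
  obtain ⟨M₂, E₂, hE₂, h₂⟩ := integral_mul_exp_deform hδ (hHc'.mul hK) fun z a b c d =>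
    (hH' z ⟨a.le, b.le⟩ (abs_le.2 ⟨c.le, by linarith⟩)).mul (differentiableAt_singKernel φ ϑ a b d)
  refine ⟨(M₁ + M₂) / 2, fun n => (E₁ n + conj (E₂ n)) / 2, fun n => ?_, fun n hn => ?_⟩
  · rw [norm_div, Complex.norm_two]
    have := (norm_add_le (E₁ n) (conj (E₂ n)))
    rw [RCLike.norm_conj] at this
    linarith [hE₁ n, hE₂ n]
  · have hint : IntervalIntegrable (fun x : ℝ => H x * singKernel φ ϑ x) MeasureTheory.volume 0
        (Real.pi / 2) := by
      refine ContinuousOn.intervalIntegrable_of_Icc Real.pi_div_two_pos.le ?_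
      exact (hHc.mul hK).comp (by fun_prop) fun x hx => ofReal_mem_lowerRect hδ.le hx
    simp only [Pi.mul_apply] at h₁ h₂
    rw [integral_mul_cos_eq_exp hint, integral_mul_exp_eq_conj, h₁, h₂]
    simp only [map_add, map_sub, map_mul, Complex.conj_I, map_pow, map_neg,
      ← intervalIntegral_conj, Complex.conj_conj, Complex.conj_ofReal, neg_neg]
    have eL : ∀ y : ℝ, H (-(y * -Complex.I)) = H (-(y * Complex.I)) := fun y => by
      rw [← heven]; ring_nf
    have eR : ∀ y : ℝ, H (((Real.pi / 2 : ℝ) : ℂ) - y * -Complex.I) =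
        σ * H (((Real.pi / 2 : ℝ) : ℂ) - y * Complex.I) := fun y => by
      rw [← hrefl]; push_cast; ring_nf
    have cL : ContinuousOn (fun y : ℝ => singKernel φ ϑ (-(y * Complex.I))) (Icc 0 δ) :=
      hK.comp (by fun_prop) fun y hy => mem_lowerRect_left hy
    have cR : ContinuousOn (fun y : ℝ => singKernel φ ϑ (((Real.pi / 2 : ℝ) : ℂ) - y * Complex.I))
        (Icc 0 δ) := hK.comp (by fun_prop) fun y hy => mem_lowerRect_right hy
    have dL : ContinuousOn (fun y : ℝ => H (-(y * Complex.I))) (Icc 0 δ) :=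
      hHc.comp (by fun_prop) fun y hy => mem_lowerRect_left hy
    have dR : ContinuousOn (fun y : ℝ => H (((Real.pi / 2 : ℝ) : ℂ) - y * Complex.I)) (Icc 0 δ) :=
      hHc.comp (by fun_prop) fun y hy => mem_lowerRect_right hy
    -- With A the values of H and B those of K, this is where the real part of the kernel cancels.
    have key : ∀ A B : ℝ → ℂ, ContinuousOn A (Icc 0 δ) → ContinuousOn B (Icc 0 δ) →
        (∫ y in (0 : ℝ)..δ, A y * B y * (Real.exp (-(n * y)) : ℂ)) -
          ∫ y in (0 : ℝ)..δ, A y * conj (B y) * (Real.exp (-(n * y)) : ℂ) =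
        2 * Complex.I * ∫ y in (0 : ℝ)..δ, A y * ((B y).im : ℂ) * (Real.exp (-(n * y)) : ℂ) := by
      intro A B hA hB
      rw [← intervalIntegral.integral_sub, ← intervalIntegral.integral_const_mul]
      · congr 1
        ext y
        linear_combination (A y * (Real.exp (-(n * y)) : ℂ)) * sub_conj_eq (B y)
      · exact ((hA.mul hB).mul (by fun_prop)).intervalIntegrable_of_Icc hδ.le
      · exact ((hA.mul hB.star).mul (by fun_prop)).intervalIntegrable_of_Icc hδ.le
    have kL := key _ _ dL cL
    have kR := key _ _ dR cR
    simp only [eL, eR, mul_assoc σ]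
    rw [intervalIntegral.integral_const_mul]
    -- The sign from reflecting H at π/2 turns the conjugated phase i^n back into (-i)^n; this is
    -- the only use of the parity of n.
    have hI : Complex.I ^ n * σ = (-Complex.I) ^ n := by
      rw [← hn, ← mul_pow, mul_neg_one]
    generalize (∫ y in (0 : ℝ)..δ, H (-(y * Complex.I)) * singKernel φ ϑ (-(y * Complex.I)) *
      (Real.exp (-(n * y)) : ℂ)) = X₁ at *
    generalize (∫ y in (0 : ℝ)..δ, H (-(y * Complex.I)) * conj (singKernel φ ϑ (-(y * Complex.I))) *
      (Real.exp (-(n * y)) : ℂ)) = X₂ at *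
    generalize (∫ y in (0 : ℝ)..δ, H (((Real.pi / 2 : ℝ) : ℂ) - y * Complex.I) *
      singKernel φ ϑ (((Real.pi / 2 : ℝ) : ℂ) - y * Complex.I) *
      (Real.exp (-(n * y)) : ℂ)) = Y₁ at *
    generalize (∫ y in (0 : ℝ)..δ, H (((Real.pi / 2 : ℝ) : ℂ) - y * Complex.I) *
      conj (singKernel φ ϑ (((Real.pi / 2 : ℝ) : ℂ) - y * Complex.I)) *
      (Real.exp (-(n * y)) : ℂ)) = Y₂ at *
    generalize (∫ y in (0 : ℝ)..δ, H (-(y * Complex.I)) *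
      ((singKernel φ ϑ (-(y * Complex.I))).im : ℂ) * (Real.exp (-(n * y)) : ℂ)) = X at *
    generalize (∫ y in (0 : ℝ)..δ, H (((Real.pi / 2 : ℝ) : ℂ) - y * Complex.I) *
      ((singKernel φ ϑ (((Real.pi / 2 : ℝ) : ℂ) - y * Complex.I)).im : ℂ) *
      (Real.exp (-(n * y)) : ℂ)) = Y at *
    linear_combination (-Complex.I / 2) * kL + (Complex.I / 2 * (-Complex.I) ^ n) * kR -
      (Complex.I / 2 * Y₂) * hI + ((-Complex.I) ^ n * Y - X) * Complex.I_mul_I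

/-- Only the side through 0 contributes to the limit. The Laplace limit at π/2 is 0, and its factor
(-i)^n has modulus one. -/
lemma tendsto_integral_mul_cos_div_logPow {φ ϑ m κ : ℝ} (hφ : 0 < φ) (hϑ : 0 ≤ ϑ) (hm : 0 ≤ m)
    (hleft : Tendsto (fun y : ℝ => (singKernel φ ϑ (-(y * Complex.I))).im /
        (y ^ (2 * φ) * (-Real.log y) ^ m)) (𝓝[>] 0) (𝓝 κ))
    (hright : Tendsto (fun y : ℝ => (singKernel φ ϑ (((Real.pi / 2 : ℝ) : ℂ) - y * Complex.I)).im /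
        (y ^ (2 * φ) * (-Real.log y) ^ m)) (𝓝[>] 0) (𝓝 0))
    {H : ℂ → ℂ} {δ : ℝ} (hδ : 0 < δ)
    (hH : ∀ z : ℂ, z.re ∈ Icc 0 (Real.pi / 2) → |z.im| ≤ δ → DifferentiableAt ℂ H z)
    (heven : ∀ z, H (-z) = H z) {σ : ℂ} (hrefl : ∀ z, H (Real.pi - z) = σ * H z) :
    Tendsto (fun n : ℕ => (∫ x in (0 : ℝ)..(Real.pi / 2), H x * singKernel φ ϑ x *
        ((Real.cos (n * x) : ℝ) : ℂ)) / (logPow m (2 * φ + 1) n : ℂ))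
      (atTop ⊓ 𝓟 {n | (-1) ^ n = σ}) (𝓝 (H 0 * κ * (Real.Gamma (2 * φ + 1) : ℂ))) := by
  obtain ⟨M, E, hE, hid⟩ := integral_mul_cos_deform hφ hϑ hδ hH heven hrefl
  have hK := continuousOn_singKernel hφ hϑ δ
  have hHc : ContinuousOn H (lowerRect δ) := fun z hz =>
    (hH z hz.1 (abs_le.2 ⟨hz.2.1, hz.2.2.trans hδ.le⟩)).continuousAt.continuousWithinAt
  have hcL : ContinuousAt H 0 := (hH 0 (by simp [Real.pi_div_two_pos.le])
    (by simpa using hδ.le)).continuousAt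
  have hcR : ContinuousAt H ((Real.pi / 2 : ℝ) : ℂ) := (hH _
    (by rw [Complex.ofReal_re]; exact ⟨Real.pi_div_two_pos.le, le_rfl⟩)
    (by simpa using hδ.le)).continuousAt
  have tL : Tendsto (fun y : ℝ => H (-(y * Complex.I))) (𝓝[>] 0) (𝓝 (H 0)) := by
    have : Tendsto (fun y : ℝ => -(y * Complex.I)) (𝓝[>] 0) (𝓝 0) := by
      have hc : Continuous fun y : ℝ => -(y * Complex.I) := by fun_prop
      simpa using (hc.tendsto 0).mono_left (nhdsWithin_le_nhds (s := Ioi 0))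
    exact hcL.tendsto.comp this
  have tR : Tendsto (fun y : ℝ => H (((Real.pi / 2 : ℝ) : ℂ) - y * Complex.I)) (𝓝[>] 0)
      (𝓝 (H ((Real.pi / 2 : ℝ) : ℂ))) := by
    have : Tendsto (fun y : ℝ => ((Real.pi / 2 : ℝ) : ℂ) - y * Complex.I) (𝓝[>] 0)
        (𝓝 ((Real.pi / 2 : ℝ) : ℂ)) := by
      have hc : Continuous fun y : ℝ => ((Real.pi / 2 : ℝ) : ℂ) - y * Complex.I := by fun_prop
      simpa using (hc.tendsto 0).mono_left (nhdsWithin_le_nhds (s := Ioi 0))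
    exact hcR.tendsto.comp this
  have lL := tendsto_laplace_div_logPow (s := 2 * φ) (m := m) (δ := δ) (c := H 0 * κ)
    (q := fun y => H (-(y * Complex.I)) * ((singKernel φ ϑ (-(y * Complex.I))).im : ℂ))
    (by linarith) hm hδ
    ((hHc.comp (by fun_prop) fun y hy => mem_lowerRect_left hy).mul
      (Complex.continuous_ofReal.comp_continuousOn (Complex.continuous_im.comp_continuousOn
        (hK.comp (by fun_prop) fun y hy => mem_lowerRect_left hy))))
    (by
      refine (tL.mul ((Complex.continuous_ofReal.tendsto _).comp hleft)).congr fun y => ?_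
      simp only [Function.comp]
      push_cast
      ring)
  have lR := tendsto_laplace_div_logPow (s := 2 * φ) (m := m) (δ := δ) (c := 0)
    (q := fun y => H (((Real.pi / 2 : ℝ) : ℂ) - y * Complex.I) *
      ((singKernel φ ϑ (((Real.pi / 2 : ℝ) : ℂ) - y * Complex.I)).im : ℂ))
    (by linarith) hm hδ
    ((hHc.comp (by fun_prop) fun y hy => mem_lowerRect_right hy).mul
      (Complex.continuous_ofReal.comp_continuousOn (Complex.continuous_im.comp_continuousOn
        (hK.comp (by fun_prop) fun y hy => mem_lowerRect_right hy))))
    (by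
      have := tR.mul ((Complex.continuous_ofReal.tendsto _).comp hright)
      rw [Complex.ofReal_zero, mul_zero] at this
      refine this.congr fun y => ?_
      simp only [Function.comp]
      push_cast
      ring)
  rw [zero_mul] at lR
  have lE : Tendsto (fun n : ℕ => E n / (logPow m (2 * φ + 1) n : ℂ)) atTop (𝓝 0) := by
    have h0 := (tendsto_exp_neg_div_logPow (q := 2 * φ + 1) hm hδ).const_mul M
    rw [mul_zero] at h0
    refine squeeze_zero_norm' ?_ h0
    filter_upwards [eventually_gt_atTop 1] with n hn
    have hp : 0 < logPow m (2 * φ + 1) n := logPow_pos (by exact_mod_cast hn)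
    rw [norm_div, Complex.norm_real, Real.norm_of_nonneg hp.le, ← mul_div_assoc]
    exact div_le_div_of_nonneg_right (hE n) hp.le
  have hunit : ∀ X : ℕ → ℂ, Tendsto X atTop (𝓝 0) →
      Tendsto (fun n => (-Complex.I) ^ n * X n) atTop (𝓝 0) := fun X hX =>
    squeeze_zero_norm (fun n => by simp) (tendsto_zero_iff_norm_tendsto_zero.1 hX)
  have lR' := hunit _ lR
  have hsum := ((lE.sub lR').add lL).mono_left (inf_le_left (b := 𝓟 {n : ℕ | (-1) ^ n = σ}))
  rw [sub_zero, zero_add] at hsum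
  refine hsum.congr' ?_
  filter_upwards [mem_inf_of_right (mem_principal_self _)] with n hn
  rw [hid n hn]
  ring

/-! ### The function u in terms of the kernel -/

lemma arccos_abs_mem {x : ℝ} : Real.arccos |x| ∈ Icc 0 (Real.pi / 2) :=
  ⟨Real.arccos_nonneg _, Real.arccos_le_pi_div_two.2 (abs_nonneg x)⟩

/-- The principal power of the nonpositive number log(1 - x²) is e^{iπϑ} times the real power of its
absolute value. The angle arccos |x| covers both halves of the interval at once. -/
lemma endpointSingular_eq (g : ℂ → ℂ) (φ ϑ : ℝ) {x : ℝ} (hx : x ∈ Icc (-1 : ℝ) 1) :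
    endpointSingular g φ ϑ x = Complex.exp (Real.pi * Complex.I * ϑ) *
      (g x * singKernel φ ϑ (Real.arccos |x|)) := by
  have h0 : 0 ≤ 1 - x ^ 2 := by nlinarith [hx.1, hx.2]
  have h1 : 1 - x ^ 2 ≤ 1 := by nlinarith
  have hl : Real.log (1 - x ^ 2) ≤ 0 := Real.log_nonpos h0 h1
  have e1 : Real.sqrt (1 - x ^ 2) ^ (2 * φ) = (1 - x ^ 2) ^ φ := by
    rw [Real.rpow_mul (Real.sqrt_nonneg _), Real.rpow_two, Real.sq_sqrt h0]
  have e2 : -2 * Real.log (Real.sqrt (1 - x ^ 2)) = -Real.log (1 - x ^ 2) := by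
    rw [Real.log_sqrt h0]
    ring
  rw [singKernel_ofReal φ ϑ arccos_abs_mem, Real.sin_arccos, sq_abs, e1, e2, Complex.ofReal_mul,
    Complex.ofReal_cpow (by linarith : 0 ≤ -Real.log (1 - x ^ 2)), endpointSingular,
    Complex.ofReal_cpow_of_nonpos hl]
  push_cast
  ring

lemma endpointSingular_neg (g : ℂ → ℂ) (φ ϑ : ℝ) (x : ℝ) :
    endpointSingular g φ ϑ (-x) = endpointSingular (fun z => g (-z)) φ ϑ x := by
  simp [endpointSingular]

lemma endpointSingular_cos (g : ℂ → ℂ) (φ ϑ : ℝ) {x : ℝ} (hx : x ∈ Icc 0 (Real.pi / 2)) :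
    endpointSingular g φ ϑ (Real.cos x) = Complex.exp (Real.pi * Complex.I * ϑ) *
      (g (Complex.cos x) * singKernel φ ϑ x) := by
  rw [endpointSingular_eq _ _ _ ⟨Real.neg_one_le_cos x, Real.cos_le_one x⟩, abs_of_nonneg
    (Real.cos_nonneg_of_neg_pi_div_two_le_of_le (by linarith [hx.1, Real.pi_pos]) hx.2),
    Real.arccos_cos hx.1 (by linarith [hx.2, Real.pi_pos]), Complex.ofReal_cos]

lemma endpointSingular_of_sq_eq_one (g : ℂ → ℂ) {φ : ℝ} (hφ : 0 < φ) (ϑ : ℝ) {x : ℝ}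
    (hx : x ^ 2 = 1) : endpointSingular g φ ϑ x = 0 := by
  simp [endpointSingular, hx, Real.zero_rpow hφ.ne']

lemma continuousOn_endpointSingular {g : ℂ → ℂ} {φ ϑ : ℝ} (hφ : 0 < φ) (hϑ : 0 ≤ ϑ)
    (hg : AnalyticOnNhd ℂ g ((fun x : ℝ => (x : ℂ)) '' Icc (-1) 1)) :
    ContinuousOn (endpointSingular g φ ϑ) (Icc (-1) 1) := by
  refine ContinuousOn.congr (f := fun x : ℝ => Complex.exp (Real.pi * Complex.I * ϑ) *
      (g x * singKernel φ ϑ (Real.arccos |x|))) ?_ fun x hx => endpointSingular_eq g φ ϑ hx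
  refine continuousOn_const.mul (ContinuousOn.mul ?_ ?_)
  · exact hg.continuousOn.comp (by fun_prop) fun x hx => mem_image_of_mem _ hx
  -- With δ = 0 the rectangle degenerates to the real segment.
  · exact (continuousOn_singKernel hφ hϑ 0).comp
      (Complex.continuous_ofReal.comp (Real.continuous_arccos.comp continuous_abs)).continuousOn
      fun x _ => ofReal_mem_lowerRect le_rfl arccos_abs_mem

lemma intervalIntegrable_sin_rpow {p : ℝ} (hp : -1 < p) :
    IntervalIntegrable (fun θ => Real.sin θ ^ p) MeasureTheory.volume 0 Real.pi := by
  -- For a nonpositive exponent Jordan's inequality sin θ ≥ 2θ/π bounds the power from above.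
  set p' : ℝ := min p 0 with hp'
  have hp1 : -1 < p' := lt_min hp (by norm_num)
  have hp0 : p' ≤ 0 := min_le_right _ _
  have h1 : IntervalIntegrable (fun θ : ℝ => θ ^ p') MeasureTheory.volume 0 Real.pi :=
    intervalIntegral.intervalIntegrable_rpow' hp1
  have h2 : IntervalIntegrable (fun θ : ℝ => (Real.pi - θ) ^ p') MeasureTheory.volume 0
      Real.pi := by
    have := (h1.comp_sub_left Real.pi).symm
    simpa using this
  have h3 := (h1.add h2).const_mul ((2 / Real.pi) ^ p')
  rw [intervalIntegrable_iff_integrableOn_Ioo_of_le Real.pi_pos.le] at h3 ⊢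
  refine h3.mono' ?_ ?_
  · refine ContinuousOn.aestronglyMeasurable ?_ measurableSet_Ioo
    exact Real.continuous_sin.continuousOn.rpow_const fun θ hθ =>
      Or.inl (Real.sin_pos_of_pos_of_lt_pi hθ.1 hθ.2).ne'
  · refine (MeasureTheory.ae_restrict_mem measurableSet_Ioo).mono fun θ hθ => ?_
    have hs := Real.sin_pos_of_pos_of_lt_pi hθ.1 hθ.2
    have hpi := Real.pi_pos
    have hθ' : 0 < Real.pi - θ := by linarith [hθ.2]
    rw [Real.norm_of_nonneg (by positivity)]
    have hle : Real.sin θ ^ p ≤ Real.sin θ ^ p' :=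
      Real.rpow_le_rpow_of_exponent_ge hs (Real.sin_le_one θ) (min_le_left _ _)
    refine hle.trans ?_
    simp only [mul_add]
    have hθ0 : 0 < θ := hθ.1
    rw [← Real.mul_rpow (by positivity) hθ0.le, ← Real.mul_rpow (by positivity) hθ'.le]
    rcases le_total θ (Real.pi / 2) with h | h
    · exact (Real.rpow_le_rpow_of_nonpos (by positivity) (Real.mul_le_sin hθ0.le h) hp0).trans
        (le_add_of_nonneg_right (by positivity))
    · rw [← Real.sin_pi_sub θ]
      exact (Real.rpow_le_rpow_of_nonpos (by positivity)
        (Real.mul_le_sin hθ'.le (by linarith)) hp0).trans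
        (le_add_of_nonneg_left (by positivity))

lemma intervalIntegrable_endpointSingular_div {g : ℂ → ℂ} {φ ϑ : ℝ} (hφ : 1 / 2 < φ) (hϑ : 0 ≤ ϑ)
    (hg : AnalyticOnNhd ℂ g ((fun x : ℝ => (x : ℂ)) '' Icc (-1) 1)) :
    IntervalIntegrable (fun θ => endpointSingular g φ ϑ (Real.cos θ) /
      ((1 - Real.cos θ ^ 2 : ℝ) : ℂ)) MeasureTheory.volume 0 Real.pi := by
  have hφ0 : 0 < φ := by linarith
  -- Keeps 2φ - ηϑ - 2, the exponent left after dividing by sin²θ, above -1; this is where φ > 1/2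
  -- enters.
  set η : ℝ := (2 * φ - 1) / (ϑ + 1) with hη'
  have hη : 0 < η := div_pos (by linarith) (by linarith)
  have hηϑ : η * ϑ < 2 * φ - 1 := by
    rw [hη', div_mul_eq_mul_div, div_lt_iff₀ (by linarith)]
    nlinarith
  obtain ⟨M, hM⟩ := (isCompact_Icc.image Complex.continuous_ofReal).exists_bound_of_continuousOn
    hg.continuousOn
  have hi := (intervalIntegrable_sin_rpow (p := 2 * φ - η * ϑ - 2) (by linarith)).const_mul
    (M * (2 * Real.pi * (1 + 1 / η)) ^ ϑ)
  have hu := continuous_comp_cos (continuousOn_endpointSingular hφ0 hϑ hg)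
  rw [intervalIntegrable_iff_integrableOn_Ioo_of_le Real.pi_pos.le] at hi ⊢
  refine hi.mono' ?_ ?_
  · refine ContinuousOn.aestronglyMeasurable ?_ measurableSet_Ioo
    refine hu.continuousOn.div (by fun_prop) fun θ hθ => ?_
    have hs := Real.sin_pos_of_pos_of_lt_pi hθ.1 hθ.2
    rw [← Real.sin_sq]
    exact Complex.ofReal_ne_zero.2 (pow_pos hs 2).ne'
  · refine (MeasureTheory.ae_restrict_mem measurableSet_Ioo).mono fun θ hθ => ?_
    have hs := Real.sin_pos_of_pos_of_lt_pi hθ.1 hθ.2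
    have hc : Real.cos θ ∈ Icc (-1 : ℝ) 1 := ⟨Real.neg_one_le_cos θ, Real.cos_le_one θ⟩
    have hsin : Complex.sin (Real.arccos |Real.cos θ| : ℝ) = (Real.sin θ : ℂ) := by
      rw [← Complex.ofReal_sin, Real.sin_arccos, sq_abs, ← Real.sin_sq, Real.sqrt_sq hs.le]
    have hnorm : ‖(Real.sin θ : ℂ)‖ = Real.sin θ := by
      rw [Complex.norm_real, Real.norm_of_nonneg hs.le]
    have hk := norm_singKernel_le (φ := φ) hϑ hη (z := (Real.arccos |Real.cos θ| : ℝ))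
      (by rw [hsin]; exact Complex.ofReal_ne_zero.2 hs.ne')
      (by rw [hsin, hnorm]; exact Real.sin_le_one θ)
    rw [hsin, hnorm] at hk
    have hgM := hM _ (mem_image_of_mem _ hc)
    have hexp : ‖Complex.exp (Real.pi * Complex.I * ϑ)‖ = 1 := by
      rw [Complex.norm_exp]; simp
    rw [endpointSingular_eq _ _ _ hc, ← Real.sin_sq, norm_div, norm_mul, norm_mul, hexp, one_mul,
      Complex.norm_real, Real.norm_of_nonneg (by positivity), Real.rpow_sub hs, Real.rpow_two,
      ← mul_div_assoc, mul_assoc]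
    exact div_le_div_of_nonneg_right
      (mul_le_mul hgM hk (norm_nonneg _) ((norm_nonneg _).trans hgM)) (by positivity)

/-- The reflection θ ↦ π - θ moves [π/2, π] onto [0, π/2], where u ∘ cos is represented by the
holomorphic kernel. -/
lemma integral_cos_fold {f : ℝ → ℂ} (hf : ContinuousOn f (Icc (-1) 1)) (n : ℕ) :
    ∫ θ in (0 : ℝ)..Real.pi, f (Real.cos θ) * ((Real.cos (n * θ) : ℝ) : ℂ) =
      ∫ θ in (0 : ℝ)..(Real.pi / 2), (f (Real.cos θ) + (-1) ^ n * f (-Real.cos θ)) *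
        ((Real.cos (n * θ) : ℝ) : ℂ) := by
  have hc := continuous_comp_cos hf
  have hi : ∀ a b : ℝ, IntervalIntegrable
      (fun θ : ℝ => f (Real.cos θ) * ((Real.cos (n * θ) : ℝ) : ℂ)) MeasureTheory.volume a b :=
    fun a b => (hc.mul (by fun_prop)).intervalIntegrable _ _
  have e : ∀ θ : ℝ, f (Real.cos (Real.pi - θ)) * ((Real.cos (n * (Real.pi - θ)) : ℝ) : ℂ) =
      (-1) ^ n * f (-Real.cos θ) * ((Real.cos (n * θ) : ℝ) : ℂ) := by
    intro θ
    rw [Real.cos_pi_sub, mul_sub, Real.cos_nat_mul_pi_sub]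
    push_cast
    ring
  have hr := intervalIntegral.integral_comp_sub_left (a := 0) (b := Real.pi / 2)
    (fun θ : ℝ => f (Real.cos θ) * ((Real.cos (n * θ) : ℝ) : ℂ)) Real.pi
  rw [sub_zero, sub_half] at hr
  simp only [e] at hr
  have hi2 : IntervalIntegrable (fun θ : ℝ => (-1) ^ n * f (-Real.cos θ) *
      ((Real.cos (n * θ) : ℝ) : ℂ)) MeasureTheory.volume 0 (Real.pi / 2) := by
    simp only [← e]
    exact ((hc.comp (continuous_const.sub continuous_id)).mul
      (by fun_prop : Continuous fun θ : ℝ =>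
        ((Real.cos (n * (Real.pi - θ)) : ℝ) : ℂ))).intervalIntegrable _ _
  rw [← intervalIntegral.integral_add_adjacent_intervals (hi 0 (Real.pi / 2)) (hi _ _), ← hr,
    ← intervalIntegral.integral_add (hi _ _) hi2]
  simp only [add_mul]

lemma exists_strip_analyticAt {g : ℂ → ℂ}
    (hg : AnalyticOnNhd ℂ g ((fun x : ℝ => (x : ℂ)) '' Icc (-1) 1)) :
    ∃ δ > 0, ∀ z : ℂ, z.re ∈ Icc 0 (Real.pi / 2) → |z.im| ≤ δ →
      AnalyticAt ℂ g (Complex.cos z) ∧ AnalyticAt ℂ g (-Complex.cos z) := by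
  set V : Set ℂ := {z | AnalyticAt ℂ g (Complex.cos z) ∧ AnalyticAt ℂ g (-Complex.cos z)}
  have hV : IsOpen V := by
    have ho := isOpen_analyticAt ℂ g
    exact (ho.preimage Complex.continuous_cos).inter (ho.preimage Complex.continuous_cos.neg)
  have hsub : (fun x : ℝ => (x : ℂ)) '' Icc 0 (Real.pi / 2) ⊆ V := by
    rintro _ ⟨x, -, rfl⟩
    refine ⟨hg _ ⟨Real.cos x, ⟨Real.neg_one_le_cos x, Real.cos_le_one x⟩, by simp⟩,
      hg _ ⟨-Real.cos x, ⟨by linarith [Real.cos_le_one x], by linarith [Real.neg_one_le_cos x]⟩,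
        by simp⟩⟩
  obtain ⟨δ, hδ, h⟩ := (isCompact_Icc.image Complex.continuous_ofReal).exists_cthickening_subset_open
    hV hsub
  refine ⟨δ, hδ, fun z h1 h2 => h ?_⟩
  refine Metric.mem_cthickening_of_dist_le z (z.re : ℂ) δ _ (mem_image_of_mem _ h1) ?_
  rw [Complex.dist_eq_re_im]
  simpa [Real.sqrt_sq_eq_abs] using h2

/-! ### Asymptotics of the three coefficient sequences -/

lemma tendsto_chebCoeff_div_logPow {g : ℂ → ℂ} {φ ϑ m κ : ℝ} (hφ : 0 < φ) (hϑ : 0 ≤ ϑ)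
    (hm : 0 ≤ m)
    (hleft : Tendsto (fun y : ℝ => (singKernel φ ϑ (-(y * Complex.I))).im /
        (y ^ (2 * φ) * (-Real.log y) ^ m)) (𝓝[>] 0) (𝓝 κ))
    (hright : Tendsto (fun y : ℝ => (singKernel φ ϑ (((Real.pi / 2 : ℝ) : ℂ) - y * Complex.I)).im /
        (y ^ (2 * φ) * (-Real.log y) ^ m)) (𝓝[>] 0) (𝓝 0))
    (hg : AnalyticOnNhd ℂ g ((fun x : ℝ => (x : ℂ)) '' Icc (-1) 1)) {σ : ℂ} (hσ : σ * σ = 1) :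
    Tendsto (fun n : ℕ => chebCoeff (endpointSingular g φ ϑ) n / (logPow m (2 * φ + 1) n : ℂ))
      (atTop ⊓ 𝓟 {n | (-1) ^ n = σ})
      (𝓝 (2 / Real.pi * Complex.exp (Real.pi * Complex.I * ϑ) * κ *
        (Real.Gamma (2 * φ + 1) : ℂ) * (g 1 + σ * g (-1)))) := by
  obtain ⟨δ, hδ, hV⟩ := exists_strip_analyticAt hg
  have h := tendsto_integral_mul_cos_div_logPow hφ hϑ hm hleft hright
    -- Replacing (-1)^n by the fixed sign σ gives one function H per parity class, with H(π - z) = σ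
    -- H(z) because σ² = 1.
    (H := fun z => g (Complex.cos z) + σ * g (-Complex.cos z)) hδ
    (fun z h1 h2 => by
      obtain ⟨a, b⟩ := hV z h1 h2
      exact (a.differentiableAt.comp z Complex.differentiableAt_cos).add
        ((b.differentiableAt.comp z Complex.differentiableAt_cos.neg).const_mul σ))
    (fun z => by simp only [Complex.cos_neg])
    (σ := σ) (fun z => by
      simp only [Complex.cos_pi_sub, neg_neg]
      linear_combination (-g (-Complex.cos z)) * hσ)
  simp only [Complex.cos_zero] at h
  have h2 := h.const_mul (2 / Real.pi * Complex.exp (Real.pi * Complex.I * ϑ))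
  rw [show 2 / (Real.pi : ℂ) * Complex.exp (Real.pi * Complex.I * ϑ) *
    ((g 1 + σ * g (-1)) * κ * (Real.Gamma (2 * φ + 1) : ℂ)) =
      2 / Real.pi * Complex.exp (Real.pi * Complex.I * ϑ) * κ *
        (Real.Gamma (2 * φ + 1) : ℂ) * (g 1 + σ * g (-1)) by ring] at h2
  refine h2.congr' ?_
  filter_upwards [mem_inf_of_right (mem_principal_self _),
    mem_inf_of_left (eventually_ne_atTop 0)] with n hn hn0
  have hn : (-1) ^ n = σ := hn
  rw [chebCoeff_eq_integral_cos, if_neg hn0,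
    integral_cos_fold (continuousOn_endpointSingular hφ hϑ hg), hn, ← mul_div_assoc, mul_assoc,
    ← intervalIntegral.integral_const_mul]
  congr 2
  refine intervalIntegral.integral_congr fun x hx => ?_
  rw [uIcc_of_le Real.pi_div_two_pos.le] at hx
  rw [endpointSingular_neg, endpointSingular_cos _ _ _ hx, endpointSingular_cos _ _ _ hx]
  ring

lemma logPowAsymp_chebCoeff {g : ℂ → ℂ} {φ ϑ : ℝ} (hφ : 0 < φ) (hϑ : 0 ≤ ϑ)
    (hsing : ϑ = 0 → ∀ m : ℕ, φ ≠ m) (hlog : (∃ k : ℕ, ϑ = k) ∨ φ ≤ ϑ)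
    (hg : AnalyticOnNhd ℂ g ((fun x : ℝ => (x : ℂ)) '' Icc (-1) 1)) :
    ∃ (m : ℝ) (C : ℂ), 0 ≤ m ∧ C ≠ 0 ∧
      LogPowAsymp m (2 * φ + 1) (fun n => C * (g 1 + (-1) ^ n * g (-1)))
        (chebCoeff (endpointSingular g φ ϑ)) := by
  obtain ⟨m, κ, hm, hκ, hleft, hright⟩ := exists_singKernel_im_asymptotics hφ hϑ hsing hlog
  set C : ℂ := 2 / Real.pi * Complex.exp (Real.pi * Complex.I * ϑ) * κ *
    (Real.Gamma (2 * φ + 1) : ℂ) with hC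
  refine ⟨m, C, hm, ?_, ?_⟩
  · have h1 : (Real.pi : ℂ) ≠ 0 := Complex.ofReal_ne_zero.2 Real.pi_ne_zero
    have h2 : (Real.Gamma (2 * φ + 1) : ℂ) ≠ 0 :=
      Complex.ofReal_ne_zero.2 (Real.Gamma_pos_of_pos (by linarith)).ne'
    exact mul_ne_zero (mul_ne_zero (mul_ne_zero (div_ne_zero two_ne_zero h1)
      (Complex.exp_ne_zero _)) (Complex.ofReal_ne_zero.2 hκ)) h2
  · have hpar : ∀ σ : ℂ, σ * σ = 1 → Tendsto (fun n : ℕ =>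
        chebCoeff (endpointSingular g φ ϑ) n / (logPow m (2 * φ + 1) n : ℂ) -
          C * (g 1 + (-1) ^ n * g (-1))) (atTop ⊓ 𝓟 {n | (-1) ^ n = σ}) (𝓝 0) := by
      intro σ hσ
      have h := (tendsto_chebCoeff_div_logPow hφ hϑ hm hleft hright hg hσ).sub_const
        (C * (g 1 + σ * g (-1)))
      rw [← hC, sub_self] at h
      refine h.congr' ?_
      filter_upwards [mem_inf_of_right (mem_principal_self _)] with n hn
      rw [show (-1 : ℂ) ^ n = σ from hn]
    -- The even and the odd indices together exhaust `atTop`.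
    have hsup : (atTop : Filter ℕ) ≤ (atTop ⊓ 𝓟 {n | (-1 : ℂ) ^ n = 1}) ⊔
        (atTop ⊓ 𝓟 {n | (-1 : ℂ) ^ n = -1}) := by
      rw [← inf_sup_left, sup_principal]
      refine le_inf le_rfl (le_principal_iff.2 (Eventually.of_forall fun n => ?_))
      exact neg_one_pow_eq_or ℂ n
    have ht := ((hpar 1 (by norm_num)).sup (hpar (-1) (by norm_num))).mono_left hsup
    have hne : ∀ᶠ n : ℕ in atTop, (logPow m (2 * φ + 1) n : ℂ) ≠ 0 :=
      (eventually_gt_atTop 1).mono fun n hn =>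
        Complex.ofReal_ne_zero.2 (logPow_pos (by exact_mod_cast hn)).ne'
    have ho : (fun n : ℕ => chebCoeff (endpointSingular g φ ϑ) n -
        C * (g 1 + (-1) ^ n * g (-1)) * (logPow m (2 * φ + 1) n : ℂ)) =o[atTop]
        fun n : ℕ => (logPow m (2 * φ + 1) n : ℂ) := by
      rw [isLittleO_iff_tendsto' (hne.mono fun n h h' => absurd h' h)]
      refine ht.congr' (hne.mono fun n hn => ?_)
      field_simp
    exact ho.trans_isBigO (isBigO_of_le _ fun n => by rw [Complex.norm_real])

lemma logPowAsymp_diffCoeff {u : ℝ → ℂ} {m φ : ℝ} {C : ℂ} {G : ℕ → ℂ} (hφ : 0 < φ)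
    (ha : LogPowAsymp m (2 * φ + 1) (fun n => C * G n) (chebCoeff u))
    (hGper : ∀ n, G (n + 2) = G n) (hGb : ∀ c : ℂ, ∃ B, ∀ n, ‖c * G n‖ ≤ B)
    (hb0 : Tendsto (diffCoeff u) atTop (𝓝 0)) :
    LogPowAsymp m (2 * φ) (fun n => 1 / (4 * φ) * C * G n) (diffCoeff u) := by
  have hφC : (φ : ℂ) ≠ 0 := Complex.ofReal_ne_zero.2 hφ.ne'
  have h := LogPowAsymp.sum_tail (q := 2 * φ) (by linarith)
    (ha.add_two (fun n => by rw [hGper]) (hGb C)) (fun n => by rw [hGper]) (hGb C) hb0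
    fun n => by simp [diffCoeff, differenceSolution]
  have e : (fun n => C * G n / (2 * ((2 * φ : ℝ) : ℂ))) = fun n => 1 / (4 * (φ : ℂ)) * C * G n := by
    ext n
    push_cast
    field_simp
    norm_num
  rwa [e] at h

/-- A second summation of tails, applied to the differences -4 b_n: the constant is -4 · 1/(4φ) ·
1/(2(2φ - 1)). Index 0 is normalised differently and does not affect the limit. -/
lemma logPowAsymp_quadCoeff {u : ℝ → ℂ} {m φ : ℝ} {C : ℂ} {G : ℕ → ℂ} (hφ : 1 / 2 < φ)
    (hb : LogPowAsymp m (2 * φ) (fun n => 1 / (4 * φ) * C * G n) (diffCoeff u))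
    (hGper : ∀ n, G (n + 2) = G n) (hGb : ∀ c : ℂ, ∃ B, ∀ n, ‖c * G n‖ ≤ B)
    (huv : ∀ x ∈ Ioo (-1 : ℝ) 1, u x = ((1 - x ^ 2 : ℝ) : ℂ) * (u x / ((1 - x ^ 2 : ℝ) : ℂ)))
    (hv : IntervalIntegrable (fun θ => u (Real.cos θ) / ((1 - Real.cos θ ^ 2 : ℝ) : ℂ))
      MeasureTheory.volume 0 Real.pi) :
    LogPowAsymp m (2 * φ - 1) (fun n => -(1 / ((2 * φ - 1) * (2 * φ))) * C * G n)
      (quadCoeff u) := by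
  have hφC : (φ : ℂ) ≠ 0 := Complex.ofReal_ne_zero.2 (by linarith)
  have hφ1 : (2 * (φ : ℂ) - 1) ≠ 0 := by
    have : (2 * φ - 1 : ℝ) ≠ 0 := by linarith
    exact_mod_cast Complex.ofReal_ne_zero.2 this
  have hsub := cosCoeff_sub_eq_diffCoeff (v := fun x => u x / ((1 - x ^ 2 : ℝ) : ℂ)) huv hv
  have hlim := tendsto_cosCoeff_zero hv
  have hq : ∀ n, n ≠ 0 → quadCoeff u n =
      cosCoeff (fun θ => u (Real.cos θ) / ((1 - Real.cos θ ^ 2 : ℝ) : ℂ)) n :=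
    fun n hn => chebCoeff_eq_cosCoeff (fun x => u x / ((1 - x ^ 2 : ℝ) : ℂ)) hn
  generalize cosCoeff (fun θ => u (Real.cos θ) / ((1 - Real.cos θ ^ 2 : ℝ) : ℂ)) = cc at *
  have h4 : LogPowAsymp m (2 * φ - 1 + 1) (fun n => -(1 / φ) * C * G n)
      (fun n => -4 * diffCoeff u n) := by
    have h := hb.const_mul (-4)
    rw [sub_add_cancel]
    have e : (fun n => -4 * (1 / (4 * (φ : ℂ)) * C * G n)) =
        fun n => -(1 / (φ : ℂ)) * C * G n := by
      ext n
      field_simp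
    rwa [e] at h
  have h5 := LogPowAsymp.sum_tail (q := 2 * φ - 1) (by linarith) h4
    (fun n => by rw [hGper]) (hGb _) hlim hsub
  have e : (fun n => -(1 / (φ : ℂ)) * C * G n / (2 * ((2 * φ - 1 : ℝ) : ℂ))) =
      fun n => -(1 / ((2 * (φ : ℂ) - 1) * (2 * φ))) * C * G n := by
    ext n
    push_cast
    field_simp
  rw [e] at h5
  refine IsLittleO.congr' h5 ?_ EventuallyEq.rfl
  filter_upwards [eventually_ne_atTop 0] with n hn
  rw [hq n hn]


end

theorem theorem1 (φ ϑ : ℝ) (hφ : 0 < φ) (hϑ : 0 ≤ ϑ)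
    (hsing : ϑ = 0 → ∀ m : ℕ, φ ≠ m)
    (hlog : (∃ k : ℕ, ϑ = k) ∨ φ ≤ ϑ)
    (g : ℂ → ℂ) (hg : AnalyticOnNhd ℂ g ((fun x : ℝ => (x : ℂ)) '' Icc (-1) 1)) :
    ExpandsIn chebT (chebCoeff (endpointSingular g φ ϑ)) (endpointSingular g φ ϑ) ∧
    ExpandsIn (fun n x => chebT (n + 2) x - chebT n x)
      (diffCoeff (endpointSingular g φ ϑ)) (endpointSingular g φ ϑ) ∧
    (1 / 2 < φ → ExpandsIn (fun n x => (1 - x ^ 2) * chebT n x)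
      (quadCoeff (endpointSingular g φ ϑ)) (endpointSingular g φ ϑ)) ∧
    ∃ A L : ℕ → ℂ, SlowlyVarying L ∧
      (∀ n, A n = (g 1 + (-1) ^ n * g (-1)) * L n) ∧
      SimWithScale (chebCoeff (endpointSingular g φ ϑ))
        (fun n => A n / (((n : ℝ) ^ (2 * φ + 1) : ℝ) : ℂ))
        (fun n => L n / (((n : ℝ) ^ (2 * φ + 1) : ℝ) : ℂ)) ∧
      SimWithScale (diffCoeff (endpointSingular g φ ϑ))
        (fun n => A n / (4 * (φ : ℂ)) * (1 / (((n : ℝ) ^ (2 * φ) : ℝ) : ℂ)))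
        (fun n => L n / (((n : ℝ) ^ (2 * φ) : ℝ) : ℂ)) ∧
      (1 / 2 < φ →
        SimWithScale (quadCoeff (endpointSingular g φ ϑ))
          (fun n => -(A n / ((2 * (φ : ℂ) - 1) * (2 * (φ : ℂ)))) *
            (1 / (((n : ℝ) ^ (2 * φ - 1) : ℝ) : ℂ)))
          (fun n => L n / (((n : ℝ) ^ (2 * φ - 1) : ℝ) : ℂ))) := by
  obtain ⟨m, C, hm, hC, ha⟩ := logPowAsymp_chebCoeff hφ hϑ hsing hlog hg
  set u := endpointSingular g φ ϑ with hu
  set G : ℕ → ℂ := fun n => g 1 + (-1) ^ n * g (-1) with hG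
  change LogPowAsymp m (2 * φ + 1) (fun n => C * G n) (chebCoeff u) at ha
  have hGper : ∀ n, G (n + 2) = G n := fun n => by simp [hG, pow_add]
  have hGb : ∀ c : ℂ, ∃ B, ∀ n, ‖c * G n‖ ≤ B := fun c => by
    refine ⟨‖c‖ * (‖g 1‖ + ‖g (-1)‖), fun n => ?_⟩
    rw [norm_mul]
    refine mul_le_mul_of_nonneg_left ((norm_add_le _ _).trans_eq ?_) (norm_nonneg _)
    rw [norm_mul, norm_pow, norm_neg, norm_one, one_pow, one_mul]
  -- G takes only the values G 0 and G 1, so its nonzero values are bounded away from zero.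
  obtain ⟨δ, hδ, hGδ⟩ : ∃ δ > 0, ∀ n, G n = 0 ∨ δ ≤ ‖G n‖ := by
    have hval : ∀ n, G n = G 0 ∨ G n = G 1 := fun n => by
      rcases neg_one_pow_eq_or ℂ n with h | h <;> simp [hG, h]
    have hone : ∀ w : ℂ, ∃ δ > 0, w = 0 ∨ δ ≤ ‖w‖ := fun w => by
      by_cases hw : w = 0
      · exact ⟨1, one_pos, Or.inl hw⟩
      · exact ⟨‖w‖, norm_pos_iff.2 hw, Or.inr le_rfl⟩
    obtain ⟨δ₀, h₀, H₀⟩ := hone (G 0)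
    obtain ⟨δ₁, h₁, H₁⟩ := hone (G 1)
    refine ⟨min δ₀ δ₁, lt_min h₀ h₁, fun n => ?_⟩
    rcases hval n with h | h <;> rw [h]
    · exact H₀.imp_right (min_le_left _ _).trans
    · exact H₁.imp_right (min_le_right _ _).trans
  have hφC : (φ : ℂ) ≠ 0 := Complex.ofReal_ne_zero.2 hφ.ne'
  have hcont := continuousOn_endpointSingular hφ hϑ hg
  have hexp := expandsIn_chebT_of_summable hcont (ha.summable (by linarith) (hGb C))
  have hb0 : Tendsto (diffCoeff u) atTop (𝓝 0) := tendsto_diffCoeff_zero hexp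
    (endpointSingular_of_sq_eq_one g hφ ϑ (by norm_num))
    (endpointSingular_of_sq_eq_one g hφ ϑ (by norm_num))
  have hexpb := expandsIn_diff hexp hb0
  have hb := logPowAsymp_diffCoeff hφ ha hGper hGb hb0
  have huv : ∀ x ∈ Ioo (-1 : ℝ) 1, u x = ((1 - x ^ 2 : ℝ) : ℂ) * (u x / ((1 - x ^ 2 : ℝ) : ℂ)) :=
    fun x hx => by
      have : (0 : ℝ) < 1 - x ^ 2 := by nlinarith [hx.1, hx.2]
      rw [mul_div_cancel₀ _ (Complex.ofReal_ne_zero.2 this.ne')]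
  refine ⟨hexp, hexpb, fun h => expandsIn_quad_of_cosCoeff huv
    (intervalIntegrable_endpointSingular_div h hϑ hg) hexpb,
    fun n => G n * (C * ((Real.log n ^ m : ℝ) : ℂ)), fun n => C * ((Real.log n ^ m : ℝ) : ℂ),
    slowlyVarying_log_rpow hm hC, fun n => rfl, ?_, ?_, fun h => ?_⟩
  · exact LogPowAsymp.simWithScale (G := G) (k := 1) (q := 2 * φ + 1) (m := m) hC one_ne_zero hδ hGδ
      (by simpa using ha) (fun n => rfl) (fun n => rfl) fun n => by ring
  · exact hb.simWithScale hC (one_div_ne_zero (mul_ne_zero (by norm_num) hφC)) hδ hGδ (fun n => rfl) (fun n => rfl) fun n => by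
      field_simp
  · have hv := intervalIntegrable_endpointSingular_div (φ := φ) (ϑ := ϑ) h hϑ hg
    have hφ1 : (2 * (φ : ℂ) - 1) ≠ 0 := by
      have : (2 * φ - 1 : ℝ) ≠ 0 := by linarith
      exact_mod_cast Complex.ofReal_ne_zero.2 this
    have hq := logPowAsymp_quadCoeff h hb hGper hGb huv hv
    refine hq.simWithScale hC ?_ hδ hGδ (fun n => rfl) (fun n => rfl) fun n => ?_
    · exact neg_ne_zero.2 (one_div_ne_zero (mul_ne_zero hφ1 (mul_ne_zero two_ne_zero hφC)))
    · field_simp
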